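/- Consider the equations of motion of $N=12$ identical vortices on the unit sphere $S^2\subset\mathbb R^3$, $$\dot v_j=\sum_{i\neq j}\frac{v_i\times v_j}{|v_j-v_i|^2},\qquad j=1,\dots,12, \qquad (1)$$ with energy $H(v)=-\frac12\sum_{i<j}\ln|v_j-v_i|^2$. Let $\mathbb T<\mathrm{SO}(3)$ be the tetrahedral group, generated by the rotations $(x,y,z)\mapsto(y,z,x)$ and $(x,y,z)\mapsto(x,-y,-z)$; it has order 12. Let $(g_1=e,g_2,\dots,g_{12})$ be any ordering of $\mathbb T$ and put $\rho(u)=(u,g_2u,\dots,g_{12}u)$ for $u\in S^2$. By a one-parameter family of $\mathbb T$-symmetric periodic solutions around the points of $v_0=\rho(u_0)$ we mean collision-free solutions $v_h(t)$ of (1), $h$ in an interval, depending continuously on $(h,t)$, with least period $P(h)>0$ continuous in $h$, such that $H(v_h(t))=h$ and $v_h(t)=\rho(v_{h,1}(t))$ for all $t$ (so the positions of all vortices at each instant, and the loops they traverse, are obtained from a single one by the action of $\mathbb T$), and such that the $j$-th vortex travels, once per period, along a simple closed loop encircling the point $g_ju_0$ inside the open hemisphere centred there; vortices $i,j$ with $g_iu_0=g_ju_0$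 travel along the same loop, and loops around distinct points are disjoint. 1. Let $u_0$ be any of the 24 points obtained from $\frac1{\sqrt{1+\phi^2}}(\pm\phi,\pm1,0)$, $\phi=\frac{1+\sqrt5}2$, by sign flips and permutations of the entries. Then $v_0=\rho(u_0)$ is an equilibrium of (1) whose vortices occupy the vertices of a regular icosahedron, and there is a one-parameter family of $\mathbb T$-symmetric periodic solutions $v_h$ around the points of $v_0$, parametrised by its energy $h\in(H(v_0),H(v_0)+\delta)$ for some $\delta>0$, which emanates from $v_0$: $\sup_{t}|v_h(t)-v_0|\to0$ as $h\downarrow H(v_0)$. Thus each vortex travels around a small closed loop around a vertex of the icosahedron. 2. Let $S$ be one of the tetrahedra $\{c(1,1,1),c(-1,-1,1),c(-1,1,-1),c(1,-1,-1)\}$, $\{c(-1,-1,-1),c(1,1,-1),c(1,-1,1),c(-1,1,1)\}$, $c=1/\sqrt3$, and let $u_0\in S$. Then $v_0=\rho(u_0)$ is a configuration with a triple collision at each of the four points of $S$, and there is a one-parameter family of $\mathbb T$-symmetric periodic solutions $v_h$ around the points of $v_0$, parametrised by its energy $h\in(h_1,\infty)$ for some $h_1$, which converges to $v_0$: $\sup_t|v_h(t)-v_0|\to0$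 and $P(h)\to0$ as $h\to\infty$. Thus three vortices travel along a closed loop around each vertex of the tetrahedron. 3. Let $u_0$ be one of the six points $(\pm1,0,0),(0,\pm1,0),(0,0,\pm1)$. Then $v_0=\rho(u_0)$ is a configuration with a binary collision at each of these six points, and there is a one-parameter family of $\mathbb T$-symmetric periodic solutions $v_h$ around the points of $v_0$, parametrised by its energy $h\in(h_1,\infty)$ for some $h_1$, with $\sup_t|v_h(t)-v_0|\to0$ and $P(h)\to0$ as $h\to\infty$. Thus a pair of vortices travels along a small closed loop around each vertex of the octahedron. -/

import Mathlib

open Real Set Filter Topology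

noncomputable section

namespace VortexSphere

/-- Euclidean three-space. -/
abbrev E3 : Type := EuclideanSpace ℝ (Fin 3)

/-- The vector product on Euclidean three-space. -/
def cross (a b : E3) : E3 := WithLp.toLp 2 (crossProduct a.ofLp b.ofLp)

/-- The rotation group `SO(3)`. -/
abbrev SO3 : Type := Matrix.specialOrthogonalGroup (Fin 3) ℝ

/-- The action of a rotation on a vector. -/
def rot (A : SO3) (u : E3) : E3 := WithLp.toLp 2 (Matrix.mulVec (A : Matrix (Fin 3) (Fin 3) ℝ) u.ofLp)

/-! ### The vortex equations -/

/-- The Hamiltonian of `N` vortices of equal strength,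
`H(v) = -1/2 * ∑_{i<j} ln |v_j - v_i|^2`. -/
def H {N : ℕ} (v : Fin N → E3) : ℝ :=
  -(1 / 2) * ∑ p ∈ Finset.univ.filter (fun p : Fin N × Fin N => p.1 < p.2),
    Real.log (‖v p.2 - v p.1‖ ^ 2)

/-- The `j`-th component of the vortex vector field,
`∑_{i ≠ j} (v_i × v_j) / |v_j - v_i|^2`. -/
def field {N : ℕ} (v : Fin N → E3) (j : Fin N) : E3 :=
  ∑ i ∈ Finset.univ.erase j, (‖v j - v i‖ ^ 2)⁻¹ • cross (v i) (v j)

/-- `v` is a solution, defined for all times, of the equations of motion of `N` equal vortices on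
the unit sphere; the vortices never collide. -/
structure IsSolution {N : ℕ} (v : ℝ → Fin N → E3) : Prop where
  on_sphere : ∀ t j, ‖v t j‖ = 1
  no_collision : ∀ t, Function.Injective (v t)
  motion : ∀ t j, HasDerivAt (fun s => v s j) (field (v t) j) t

/-- `v₀` is a (collision-free) equilibrium configuration. -/
def IsEquilibrium {N : ℕ} (v₀ : Fin N → E3) : Prop :=
  IsSolution (fun _ : ℝ => v₀)

/-! ### The tetrahedral group -/

/-- The rotation `(x, y, z) ↦ (y, z, x)`. -/
def genA : SO3 :=
  ⟨!![0, 1, 0; 0, 0, 1; 1, 0, 0], by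
    rw [Matrix.mem_specialOrthogonalGroup_iff, Matrix.mem_orthogonalGroup_iff]
    constructor
    · ext i j
      fin_cases i <;> fin_cases j <;>
        simp [Matrix.mul_apply, Fin.sum_univ_three]
    · simp [Matrix.det_fin_three]⟩

/-- The rotation `(x, y, z) ↦ (x, -y, -z)`. -/
def genB : SO3 :=
  ⟨!![1, 0, 0; 0, -1, 0; 0, 0, -1], by
    rw [Matrix.mem_specialOrthogonalGroup_iff, Matrix.mem_orthogonalGroup_iff]
    constructor
    · ext i j
      fin_cases i <;> fin_cases j <;>
        simp [Matrix.mul_apply, Fin.sum_univ_three]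
    · simp [Matrix.det_fin_three]⟩

/-- The tetrahedral group `𝕋`, as the subgroup of `SO(3)` generated by two rotations. -/
def tetGroup : Subgroup SO3 := Subgroup.closure {genA, genB}

/-- The configuration `(u, g₂ u, …, g₁₂ u)` determined by an ordering `g` of `𝕋`. -/
def rho (g : Fin 12 ≃ tetGroup) (u : E3) : Fin 12 → E3 := fun j => rot (g j) u

/-! ### Distinguished points and polyhedra -/

/-- The vertices of the tetrahedron `𝒯₁ = {c(1,1,1), c(-1,-1,1), c(-1,1,-1), c(1,-1,-1)}`,
`c = 1/√3`. -/
def tet1 : Set E3 :=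
  {u | ∃ w ∈ ({!₂[1, 1, 1], !₂[-1, -1, 1], !₂[-1, 1, -1], !₂[1, -1, -1]} : Set E3),
    u = (√3)⁻¹ • w}

/-- The vertices of the tetrahedron `𝒯₂ = {c(-1,-1,-1), c(1,1,-1), c(1,-1,1), c(-1,1,1)}`,
`c = 1/√3`. -/
def tet2 : Set E3 :=
  {u | ∃ w ∈ ({!₂[-1, -1, -1], !₂[1, 1, -1], !₂[1, -1, 1], !₂[-1, 1, 1]} : Set E3),
    u = (√3)⁻¹ • w}

/-- The vertices `(±1,0,0), (0,±1,0), (0,0,±1)` of the octahedron. -/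
def octa : Set E3 :=
  {!₂[1, 0, 0], !₂[-1, 0, 0], !₂[0, 1, 0], !₂[0, -1, 0], !₂[0, 0, 1], !₂[0, 0, -1]}

/-- The 24 points obtained from `(1+φ²)^(-1/2) • (±φ, ±1, 0)` by sign flips and permutations of
the entries, `φ` the golden mean. -/
def icoPoints : Set E3 :=
  {u | ∃ σ : Equiv.Perm (Fin 3), |u (σ 0)| = goldenRatio / √(1 + goldenRatio ^ 2) ∧
    |u (σ 1)| = 1 / √(1 + goldenRatio ^ 2) ∧ u (σ 2) = 0}

/-- The 12 vertices of the standard regular icosahedron inscribed in the unit sphere: the cyclic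
permutations of `(1+φ²)^(-1/2) • (±φ, ±1, 0)`. -/
def stdIcosahedron : Set E3 :=
  {u | ∃ i : Fin 3, |u i| = goldenRatio / √(1 + goldenRatio ^ 2) ∧
    |u (i + 1)| = 1 / √(1 + goldenRatio ^ 2) ∧ u (i + 2) = 0}

/-- `S` is the set of vertices of a regular icosahedron inscribed in the unit sphere. -/
def IsRegularIcosahedron (S : Set E3) : Prop :=
  ∃ A : E3 ≃ₗᵢ[ℝ] E3, S = A '' stdIcosahedron

/-! ### Closed loops and families of periodic solutions -/

/-- `γ` traverses, with least period `P`, a simple closed loop around the point `p` of the unit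
sphere: the loop lies in the open hemisphere centred at `p`, and in polar coordinates about `p`
(with `e₁, e₂` an orthonormal basis, of either orientation, of the tangent plane at `p`) its polar
angle increases by exactly `2π` over one period, while the polar radius stays positive. -/
structure IsLoopAround (γ : ℝ → E3) (P : ℝ) (p : E3) : Prop where
  continuous : Continuous γ
  on_sphere : ∀ t, ‖γ t‖ = 1
  pos : 0 < P
  periodic : Function.Periodic γ P
  simple : InjOn γ (Ico 0 P)
  around : ∃ e₁ e₂ : E3, Orthonormal ℝ ![p, e₁, e₂] ∧
    ∃ z r θ : ℝ → ℝ, Continuous θ ∧ (∀ t, 0 < z t) ∧ (∀ t, 0 < r t) ∧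
      (∀ t, γ t = z t • p + (r t * cos (θ t)) • e₁ + (r t * sin (θ t)) • e₂) ∧
      ∀ t, θ (t + P) = θ t + 2 * π

/-- `v` is a one-parameter family `v_h`, `h ∈ I`, of `𝕋`-symmetric periodic solutions of the
equations of motion of 12 vortices, with least periods `P h`, parametrised by their energy `h`, and
winding around the points of the configuration `v₀` (in which points may be repeated). -/
structure IsPeriodicFamily (g : Fin 12 ≃ tetGroup) (v₀ : Fin 12 → E3) (I : Set ℝ)
    (v : ℝ → ℝ → Fin 12 → E3) (P : ℝ → ℝ) : Prop where
  /-- Every member is a solution of the equations of motion. -/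
  solution : ∀ h ∈ I, IsSolution (v h)
  /-- Every member is `𝕋`-symmetric: at each instant the positions of all vortices are obtained
  from the position of a single one by the action of `𝕋`. -/
  symmetric : ∀ h ∈ I, ∀ t, v h t = rho g (v h t 0)
  /-- The parameter is the energy. -/
  energy : ∀ h ∈ I, ∀ t, H (v h t) = h
  /-- `P h` is the least positive period of `v h`. -/
  period : ∀ h ∈ I, IsLeast {s | 0 < s ∧ Function.Periodic (v h) s} (P h)
  /-- The family depends continuously on the parameter. -/
  continuousOn : ContinuousOn (fun x : ℝ × ℝ => v x.1 x.2) (I ×ˢ univ)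
  continuousOn_period : ContinuousOn P I
  /-- The `j`-th vortex travels along a closed loop around the `j`-th point of `v₀`. -/
  loop : ∀ h ∈ I, ∀ j, IsLoopAround (fun t => v h t j) (P h) (v₀ j)
  /-- Vortices around the same point travel along the same loop. -/
  same_loop : ∀ h ∈ I, ∀ i j, v₀ i = v₀ j →
    range (fun t => v h t i) = range (fun t => v h t j)
  /-- Loops around distinct points are disjoint. -/
  disjoint_loops : ∀ h ∈ I, ∀ i j, v₀ i ≠ v₀ j →
    Disjoint (range (fun t => v h t i)) (range (fun t => v h t j))

/-- There is a one-parameter family of `𝕋`-symmetric periodic solutions emanating from the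
equilibrium `v₀`: it is parametrised by the energies slightly above that of `v₀`, and its members
shrink to `v₀` as the energy decreases to that of `v₀`. -/
def EmanatesFrom (g : Fin 12 ≃ tetGroup) (v₀ : Fin 12 → E3) : Prop :=
  ∃ δ > 0, ∃ (v : ℝ → ℝ → Fin 12 → E3) (P : ℝ → ℝ),
    IsPeriodicFamily g v₀ (Ioo (H v₀) (H v₀ + δ)) v P ∧
    TendstoUniformly v (fun _ => v₀) (𝓝[>] (H v₀))

/-- There is a one-parameter family of `𝕋`-symmetric periodic solutions converging to the
collision configuration `v₀`: it is parametrised by all sufficiently large energies, and as the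
energy tends to infinity its members shrink to `v₀` and their periods tend to zero. -/
def ConvergesToCollision (g : Fin 12 ≃ tetGroup) (v₀ : Fin 12 → E3) : Prop :=
  ∃ (h₁ : ℝ) (v : ℝ → ℝ → Fin 12 → E3) (P : ℝ → ℝ),
    IsPeriodicFamily g v₀ (Ioi h₁) v P ∧
    TendstoUniformly v (fun _ => v₀) atTop ∧
    Tendsto P atTop (𝓝 0)

/-- In the configuration `v₀` of 12 vortices there is, at each point of `S` and nowhere else, a
`k`-tuple collision. -/
def IsCollisionAt (v₀ : Fin 12 → E3) (S : Set E3) (k : ℕ) : Prop :=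
  range v₀ = S ∧ ∀ p ∈ S, {j | v₀ j = p}.ncard = k

end VortexSphere

end

noncomputable section

namespace VortexSphere

/-! The vortex field commutes with 𝕋, so a configuration `rho g u` evolves through the motion of the
single point u. That motion is u' = (1/12) ∇E(u) × u with E(u) = H(`rho g u`) (`sum_cross_eq`,
`field_rho_eq`): a Hamiltonian system with one degree of freedom on the sphere, whose orbits lie on
level curves of E. A rotation by α about a unit axis a moves u by a squared distance 4 sin²(α/2)(1 -
⟨a,u⟩²), so E is, up to a constant, a sum of logarithms attached to the seven axes of 𝕋
(`H_rho_eq_energy`).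

Around a pole p, the height z = ⟨p,u⟩ and the polar angle θ are canonical coordinates
(`IsFrame.velocity`). Where E is strictly monotone in z, each level curve near p is a closed graph z
= ζ(θ), and the angle advances at the positive speed |∂E/∂z|/12. The motion along it is thus
periodic, its period being the integral of the reciprocal speed (`exists_loops`). Applying 𝕋 to such
a loop gives the family (`exists_periodicFamily`): the stabiliser of p preserves the loop, and
disjoint caps keep loops around different points apart.

It remains to check monotonicity towards each pole. If p lies on an axis, one logarithm blows up and
dominates everything else: E and ∂E/∂z tend to infinity, so high energy levels shrink to p and the
periods tend to 0 (`convergesToCollision_of_axis`). At a vertex of the icosahedron ∇E = 60 p, while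
the Euclidean Hessian is at least 75 on the tangent plane. The Hessian of E on the sphere is
therefore at least 15, p is a nondegenerate minimum, and E decreases towards it
(`icoPoints_critical`, `emanatesFrom_of_minimum`). -/

/-! ### Flows along the level curves of a planar Hamiltonian -/

/-- A solution `g x` of `f x (g x) = c x`, where `f x` is strictly increasing, depends continuously
on the parameter `x`. -/
theorem continuous_of_strictMonoOn_eq {X : Type*} [TopologicalSpace X] {f : X → ℝ → ℝ}
    {g c : X → ℝ} {s : Set ℝ} (hs : IsOpen s) (hf : ∀ x, StrictMonoOn (f x) s)
    (hfc : ∀ y ∈ s, Continuous fun x => f x y) (hc : Continuous c) (hg : ∀ x, g x ∈ s)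
    (he : ∀ x, f x (g x) = c x) : Continuous g := by
  rw [continuous_iff_continuousAt]
  intro x₀
  rw [ContinuousAt, Metric.tendsto_nhds]
  intro ε hε
  obtain ⟨η, hη, hball⟩ := Metric.isOpen_iff.1 hs (g x₀) (hg x₀)
  set d := min η ε / 2 with hd
  have hd0 : 0 < d := by positivity
  have hdη : d < η := by have := min_le_left η ε; linarith
  have hdε : d < ε := by have := min_le_right η ε; linarith
  have h1 : g x₀ - d ∈ s := hball (by simp [abs_of_pos hd0, hdη])
  have h2 : g x₀ + d ∈ s := hball (by simp [abs_of_pos hd0, hdη])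
  have l1 : f x₀ (g x₀ - d) < c x₀ := by
    rw [← he]; exact hf x₀ h1 (hg x₀) (by linarith)
  have l2 : c x₀ < f x₀ (g x₀ + d) := by
    rw [← he]; exact hf x₀ (hg x₀) h2 (by linarith)
  -- The strict inequalities at the two fixed values `g x₀ ± d` persist for nearby x, and
  -- monotonicity of `f x` traps `g x` between these values.
  filter_upwards [((hfc _ h1).continuousAt).eventually_lt hc.continuousAt l1,
    hc.continuousAt.eventually_lt ((hfc _ h2).continuousAt) l2] with x m1 m2
  rw [← he] at m1 m2
  have := ((hf x).lt_iff_lt h1 (hg x)).1 m1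
  have := ((hf x).lt_iff_lt (hg x) h2).1 m2
  rw [Real.dist_eq, abs_lt]
  constructor <;> linarith

/-- Implicit differentiation along a continuous solution of `K (ζ θ) θ = const`. -/
theorem hasDerivAt_of_level {K : ℝ → ℝ → ℝ} {ζ : ℝ → ℝ} {θ a b : ℝ} (ha : a ≠ 0)
    (hK : HasFDerivAt (fun q : ℝ × ℝ => K q.1 q.2)
      (a • ContinuousLinearMap.fst ℝ ℝ ℝ + b • ContinuousLinearMap.snd ℝ ℝ ℝ) (ζ θ, θ))
    (hζ : ContinuousAt ζ θ) (hlev : ∀ s, K (ζ s) s = K (ζ θ) θ) :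
    HasDerivAt ζ (-(b / a)) θ := by
  have hcomp : Tendsto (fun s => (ζ s, s)) (𝓝 θ) (𝓝 (ζ θ, θ)) :=
    hζ.prodMk_nhds continuousAt_id
  have h1 := hK.isLittleO.comp_tendsto hcomp
  rw [hasDerivAt_iff_isLittleO]
  rw [Asymptotics.isLittleO_iff] at h1 ⊢
  intro c hc
  have ha' : 0 < |a| := abs_pos.2 ha
  set q := |b / a| with hq
  have hq0 : 0 ≤ q := abs_nonneg _
  -- The bound 1/2 allows the term e|w| to be absorbed on the left; the second bound then makes the
  -- remainder at most c|s - θ|.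
  set e := min (1 / 2) (c / (2 * (1 + q))) with he
  have he0 : 0 < e := by positivity
  filter_upwards [h1 (mul_pos ha' he0)] with s hs
  have hle : ‖((ζ s, s) : ℝ × ℝ) - (ζ θ, θ)‖ ≤ |ζ s - ζ θ| + |s - θ| := by
    rw [Prod.norm_def]
    simp only [Prod.fst_sub, Prod.snd_sub, Real.norm_eq_abs]
    exact max_le (by linarith [abs_nonneg (s - θ)]) (by linarith [abs_nonneg (ζ s - ζ θ)])
  simp only [Function.comp, hlev s, sub_self, add_apply,
    smul_apply, ContinuousLinearMap.coe_fst', ContinuousLinearMap.coe_snd',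
    Prod.fst_sub, Prod.snd_sub, smul_eq_mul, zero_sub, norm_neg] at hs
  set w := ζ s - ζ θ - (s - θ) * -(b / a) with hw
  have e1 : a * (ζ s - ζ θ) + b * (s - θ) = a * w := by rw [hw]; field_simp; ring
  have e2 : |ζ s - ζ θ| ≤ |w| + q * |s - θ| := by
    have : ζ s - ζ θ = w + (-(b / a)) * (s - θ) := by rw [hw]; ring
    calc |ζ s - ζ θ| ≤ |w| + |(-(b / a)) * (s - θ)| := by rw [this]; exact abs_add_le _ _
      _ = _ := by rw [abs_mul, abs_neg]
  rw [e1, norm_mul, Real.norm_eq_abs, Real.norm_eq_abs, mul_assoc] at hs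
  have e3 : |w| ≤ e * (|ζ s - ζ θ| + |s - θ|) :=
    (le_of_mul_le_mul_left hs ha').trans (by gcongr)
  have e4 : e ≤ 1 / 2 := min_le_left _ _
  have e5 : e * (2 * (1 + q)) ≤ c := by
    have := min_le_right (1 / 2) (c / (2 * (1 + q)))
    rwa [← he, le_div_iff₀ (by positivity)] at this
  rw [smul_eq_mul, Real.norm_eq_abs, Real.norm_eq_abs]
  have e6 : |w| ≤ e * (|w| + (1 + q) * |s - θ|) :=
    e3.trans (mul_le_mul_of_nonneg_left (by linarith) he0.le)
  have e7 : e * |w| ≤ 1 / 2 * |w| := by gcongr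
  have e8 : e * (2 * (1 + q)) * |s - θ| ≤ c * |s - θ| := by gcongr
  nlinarith

/-- The time law along a family of curves with positive, `2π`-periodic angular velocity `ω`. -/
theorem exists_angle_of_velocity {I : Set ℝ} {ω : ℝ → ℝ → ℝ}
    (hpos : ∀ h ∈ I, ∀ θ, 0 < ω h θ) (hper : ∀ h ∈ I, ∀ θ, ω h (θ + 2 * π) = ω h θ)
    (hcont : ContinuousOn (fun x : ℝ × ℝ => ω x.1 x.2) (I ×ˢ univ)) :
    ∃ (T : ℝ → ℝ → ℝ) (P : ℝ → ℝ),
      (∀ h ∈ I, ∀ t, HasDerivAt (T h) (ω h (T h t)) t) ∧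
      ContinuousOn (fun x : ℝ × ℝ => T x.1 x.2) (I ×ˢ univ) ∧ ContinuousOn P I ∧
      (∀ h ∈ I, 0 < P h) ∧ (∀ h ∈ I, ∀ t, T h (t + P h) = T h t + 2 * π) ∧
      (∀ h ∈ I, StrictMono (T h)) ∧ (∀ h ∈ I, Function.Surjective (T h)) ∧
      ∀ h ∈ I, ∀ M > 0, (∀ θ, M ≤ ω h θ) → P h ≤ 2 * π / M := by
  have hw : Continuous fun x : I × ℝ => (ω x.1 x.2)⁻¹ := by
    refine Continuous.inv₀ ?_ fun x => (hpos _ x.1.2 _).ne'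
    have := hcont.comp_continuous (f := fun x : I × ℝ => ((x.1 : ℝ), x.2)) (by fun_prop)
      (fun x => ⟨x.1.2, mem_univ _⟩)
    exact this
  have hwc : ∀ h : I, Continuous fun θ => (ω h θ)⁻¹ := fun h =>
    hw.comp (Continuous.prodMk_right h)
  have hwi : ∀ (h : I) (a b : ℝ), IntervalIntegrable (fun θ => (ω h θ)⁻¹) MeasureTheory.volume a b :=
    fun h a b => (hwc h).intervalIntegrable a b
  -- τ is the time needed to turn from angle 0 to angle θ; the motion is its inverse function and
  -- the period is τ(2π).
  let τ : I → ℝ → ℝ := fun h θ => ∫ s in (0 : ℝ)..θ, (ω h s)⁻¹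
  have hτc : Continuous fun x : I × ℝ => τ x.1 x.2 := by
    have := intervalIntegral.continuous_parametric_intervalIntegral_of_continuous
      (μ := MeasureTheory.volume) (a₀ := 0) (X := I × ℝ)
      (f := fun x s => (ω x.1 s)⁻¹) (s := fun x => x.2)
      (hw.comp (by fun_prop : Continuous fun y : (I × ℝ) × ℝ => (y.1.1, y.2))) continuous_snd
    exact this
  have hτd : ∀ (h : I) θ, HasDerivAt (τ h) (ω h θ)⁻¹ θ := fun h θ =>
    (hwc h).integral_hasStrictDerivAt 0 θ |>.hasDerivAt
  have hτm : ∀ h : I, StrictMono (τ h) := fun h =>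
    strictMono_of_hasDerivAt_pos (hτd h) fun θ => inv_pos.2 (hpos _ h.2 θ)
  let p : I → ℝ := fun h => τ h (2 * π)
  have hτ0 : ∀ h : I, τ h 0 = 0 := fun h => by simp [τ]
  have hp0 : ∀ h : I, 0 < p h := fun h => by
    rw [← hτ0 h]; exact hτm h (by positivity)
  have hτp : ∀ (h : I) θ, τ h (θ + 2 * π) = τ h θ + p h := by
    intro h θ
    have hP : Function.Periodic (fun s => (ω h s)⁻¹) (2 * π) := fun s => by
      simp only [hper _ h.2]
    have := hP.intervalIntegral_add_eq θ 0
    rw [zero_add] at this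
    simp only [τ, p]
    rw [← intervalIntegral.integral_add_adjacent_intervals (hwi h 0 θ) (hwi h θ (θ + 2 * π)), this]
  -- Used only to see that τ is unbounded in both directions, hence surjective.
  have hτn : ∀ (h : I) (n : ℤ), τ h (n * (2 * π)) = n * p h := by
    intro h n
    induction n using Int.induction_on with
    | zero => simp [hτ0]
    | succ n ih => 
      push_cast at ih ⊢
      rw [add_mul, one_mul, hτp, ih]; ring
    | pred n ih =>
      have := hτp h ((-(n : ℤ) - 1 : ℤ) * (2 * π))
      push_cast at ih this ⊢
      rw [show (-(n : ℝ) - 1) * (2 * π) + 2 * π = -n * (2 * π) by ring, ih] at this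
      linarith
  have hsurj : ∀ h : I, Function.Surjective (τ h) := by
    intro h t
    have hc : Continuous (τ h) := continuous_iff_continuousAt.2 fun θ => (hτd h θ).continuousAt
    obtain ⟨n, hn⟩ := exists_int_lt (t / p h)
    obtain ⟨m, hm⟩ := exists_int_gt (t / p h)
    rw [lt_div_iff₀ (hp0 h), ← hτn] at hn
    rw [div_lt_iff₀ (hp0 h), ← hτn] at hm
    exact mem_range_of_exists_le_of_exists_ge hc ⟨_, hn.le⟩ ⟨_, hm.le⟩
  choose S hS using hsurj
  have hSc : Continuous fun x : I × ℝ => S x.1 x.2 := by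
    refine continuous_of_strictMonoOn_eq (f := fun x θ => τ x.1 θ) (c := fun x => x.2) isOpen_univ
      (fun x => (hτm x.1).strictMonoOn _) (fun y _ => ?_) continuous_snd (fun _ => mem_univ _)
      (fun x => hS x.1 x.2)
    exact hτc.comp (by fun_prop : Continuous fun x : I × ℝ => (x.1, y))
  classical
  let T : ℝ → ℝ → ℝ := fun h t => if hh : h ∈ I then S ⟨h, hh⟩ t else 0
  let P : ℝ → ℝ := fun h => if hh : h ∈ I then p ⟨h, hh⟩ else 0
  have hT : ∀ h : I, T h = S h := fun h => by funext t; simp [T]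
  have hP : ∀ h : I, P h = p h := fun h => by simp [P]
  refine ⟨T, P, ?_, ?_, ?_, ?_, ?_, ?_, ?_, ?_⟩
  · intro h hh t
    lift h to I using hh
    rw [hT]
    have := HasDerivAt.of_local_left_inverse (g := S h) (a := t)
      (hSc.comp (Continuous.prodMk_right h)).continuousAt (hτd h (S h t))
      (inv_pos.2 (hpos _ h.2 _)).ne' (Eventually.of_forall fun y => hS h y)
    simpa using this
  · rw [continuousOn_iff_continuous_domRestrict]
    have : Continuous fun x : (I ×ˢ univ : Set (ℝ × ℝ)) => S ⟨x.1.1, x.2.1⟩ x.1.2 :=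
      hSc.comp (f := fun x : (I ×ˢ univ : Set (ℝ × ℝ)) => ((⟨x.1.1, x.2.1⟩ : I), x.1.2))
        (by fun_prop)
    convert this using 1
    funext x
    exact congrFun (hT ⟨x.1.1, x.2.1⟩) _
  · rw [continuousOn_iff_continuous_domRestrict]
    have : Continuous p := hτc.comp (by fun_prop : Continuous fun h : I => (h, 2 * π))
    convert this using 1
    funext x
    exact hP x
  · intro h hh
    lift h to I using hh
    rw [hP]; exact hp0 h
  · intro h hh t
    lift h to I using hh
    rw [hP, hT]
    apply (hτm h).injective
    rw [hS, hτp, hS]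
  · intro h hh s t hst
    lift h to I using hh
    rw [hT, ← (hτm h).lt_iff_lt, hS, hS]
    exact hst
  · intro h hh θ
    lift h to I using hh
    rw [hT]
    exact ⟨τ h θ, (hτm h).injective (hS h _)⟩
  · intro h hh M hM hle
    lift h to I using hh
    rw [hP]
    have : p h ≤ ∫ s in (0 : ℝ)..(2 * π), M⁻¹ :=
      intervalIntegral.integral_mono_on (by positivity) (hwi h _ _) (by simp)
        fun s _ => inv_anti₀ hM (hle s)
    simpa [div_eq_mul_inv] using this

/-- The Hamiltonian system `ż = -∂K/∂θ`, `θ̇ = ∂K/∂z` on a strip, with `K` increasing in `z` and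
`2π`-periodic in `θ`: the motion along its level curves `K = c h`. -/
theorem exists_level_flow {K Kz Kθ : ℝ → ℝ → ℝ} {z₀ : ℝ} {I : Set ℝ} {c : ℝ → ℝ}
    (hK : ∀ z ∈ Ioo z₀ 1, ∀ θ, HasFDerivAt (fun q : ℝ × ℝ => K q.1 q.2)
      (Kz z θ • ContinuousLinearMap.fst ℝ ℝ ℝ + Kθ z θ • ContinuousLinearMap.snd ℝ ℝ ℝ) (z, θ))
    (hpos : ∀ z ∈ Ioo z₀ 1, ∀ θ, 0 < Kz z θ)
    (hKzc : ContinuousOn (fun q : ℝ × ℝ => Kz q.1 q.2) (Ioo z₀ 1 ×ˢ univ))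
    (hKp : ∀ z θ, K z (θ + 2 * π) = K z θ) (hKzp : ∀ z θ, Kz z (θ + 2 * π) = Kz z θ)
    (hc : ContinuousOn c I) (hI : ∀ h ∈ I, ∀ θ, ∃ z ∈ Ioo z₀ 1, K z θ = c h) :
    ∃ (Z T : ℝ → ℝ → ℝ) (P : ℝ → ℝ),
      (∀ h ∈ I, ∀ t, Z h t ∈ Ioo z₀ 1 ∧ K (Z h t) (T h t) = c h) ∧
      (∀ h ∈ I, ∀ t, HasDerivAt (Z h) (-Kθ (Z h t) (T h t)) t) ∧
      (∀ h ∈ I, ∀ t, HasDerivAt (T h) (Kz (Z h t) (T h t)) t) ∧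
      ContinuousOn (fun x : ℝ × ℝ => Z x.1 x.2) (I ×ˢ univ) ∧
      ContinuousOn (fun x : ℝ × ℝ => T x.1 x.2) (I ×ˢ univ) ∧ ContinuousOn P I ∧
      (∀ h ∈ I, 0 < P h) ∧ (∀ h ∈ I, ∀ t, T h (t + P h) = T h t + 2 * π) ∧
      (∀ h ∈ I, ∀ t, Z h (t + P h) = Z h t) ∧
      (∀ h ∈ I, StrictMono (T h)) ∧
      (∀ h ∈ I, ∀ z ∈ Ioo z₀ 1, ∀ θ, K z θ = c h → ∃ t, Z h t = z ∧ T h t = θ) ∧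
      ∀ h ∈ I, ∀ M > 0, (∀ z ∈ Ioo z₀ 1, ∀ θ, K z θ = c h → M ≤ Kz z θ) → P h ≤ 2 * π / M := by
  have hmono : ∀ θ, StrictMonoOn (fun z => K z θ) (Ioo z₀ 1) := by
    intro θ
    have hd : ∀ z ∈ Ioo z₀ 1, HasDerivAt (fun z => K z θ) (Kz z θ) z := by
      intro z hz
      have h1 : HasDerivAt (fun z : ℝ => (z, θ)) ((1 : ℝ), (0 : ℝ)) z :=
        (hasDerivAt_id z).prodMk (hasDerivAt_const z θ)
      have h2 := (hK z hz θ).comp_hasDerivAt z h1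
      simp only [add_apply, smul_apply, ContinuousLinearMap.coe_fst',
        ContinuousLinearMap.coe_snd', smul_eq_mul, mul_one, mul_zero, add_zero] at h2
      exact h2
    refine strictMonoOn_of_deriv_pos (convex_Ioo _ _)
      (fun z hz => (hd z hz).continuousAt.continuousWithinAt) fun z hz => ?_
    rw [interior_Ioo] at hz
    rw [(hd z hz).deriv]
    exact hpos z hz θ
  have hKc : ∀ z ∈ Ioo z₀ 1, Continuous fun θ => K z θ := by
    intro z hz
    rw [continuous_iff_continuousAt]
    intro θ
    exact ContinuousAt.comp (f := fun θ : ℝ => (z, θ)) (hK z hz θ).continuousAt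
      (Continuous.prodMk_right z).continuousAt
  choose! ζ hζ hζK using hI
  -- ζ h is the level curve as a graph over the angle; uniqueness of the height yields its
  -- periodicity.
  have huniq : ∀ h ∈ I, ∀ z ∈ Ioo z₀ 1, ∀ θ, K z θ = c h → z = ζ h θ := fun h hh z hz θ e =>
    (hmono θ).injOn hz (hζ h hh θ) (e.trans (hζK h hh θ).symm)
  have hζp : ∀ h ∈ I, ∀ θ, ζ h (θ + 2 * π) = ζ h θ := fun h hh θ =>
    huniq h hh _ (hζ h hh _) θ (by rw [← hKp, hζK h hh])
  have hζc : Continuous fun x : I × ℝ => ζ x.1 x.2 := by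
    refine continuous_of_strictMonoOn_eq (X := I × ℝ) (f := fun x z => K z x.2)
      (c := fun x => c x.1)
      isOpen_Ioo (fun x => hmono x.2) (fun z hz => (hKc z hz).comp continuous_snd) ?_
      (fun x => hζ _ x.1.2 _) (fun x => hζK _ x.1.2 _)
    exact (continuousOn_iff_continuous_domRestrict.1 hc).comp continuous_fst
  have hζc' : ContinuousOn (fun x : ℝ × ℝ => ζ x.1 x.2) (I ×ˢ univ) := by
    rw [continuousOn_iff_continuous_domRestrict]
    exact hζc.comp (f := fun x : (I ×ˢ univ : Set (ℝ × ℝ)) => ((⟨x.1.1, x.2.1⟩ : I), x.1.2))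
        (by fun_prop)
  obtain ⟨T, P, hTd, hTc, hPc, hP0, hTP, hTm, hTs, hPM⟩ :=
    exists_angle_of_velocity (I := I) (ω := fun h θ => Kz (ζ h θ) θ)
    (fun h hh θ => hpos _ (hζ h hh θ) θ)
    (fun h hh θ => by rw [hζp h hh, hKzp])
    (hKzc.comp (hζc'.prodMk continuousOn_snd) fun x hx => ⟨hζ _ hx.1 _, mem_univ _⟩)
  refine ⟨fun h t => ζ h (T h t), T, P, fun h hh t => ⟨hζ h hh _, hζK h hh _⟩, ?_, hTd, ?_, hTc,
    hPc, hP0, hTP, fun h hh t => ?_, hTm, ?_, ?_⟩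
  · intro h hh t
    -- Only the angular equation had to be integrated: the slope of the level curve is -Kθ/Kz, and
    -- multiplying by the angular speed Kz gives the equation for z.
    have h1 : HasDerivAt (ζ h) (-(Kθ (ζ h (T h t)) (T h t) / Kz (ζ h (T h t)) (T h t))) (T h t) :=
      hasDerivAt_of_level (hpos _ (hζ h hh _) _).ne' (hK _ (hζ h hh _) _)
        (hζc.comp (Continuous.prodMk_right (⟨h, hh⟩ : I))).continuousAt
        fun s => by rw [hζK h hh, hζK h hh]
    have h2 := h1.comp t (hTd h hh t)
    rw [neg_mul, div_mul_cancel₀ _ (hpos _ (hζ h hh (T h t)) (T h t)).ne'] at h2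
    exact h2
  · exact hζc'.comp (continuousOn_fst.prodMk hTc) fun x hx => ⟨hx.1, mem_univ _⟩
  · simp only [hTP h hh, hζp h hh]
  · intro h hh z hz θ e
    obtain ⟨t, ht⟩ := hTs h hh θ
    exact ⟨t, by simp only [ht]; exact (huniq h hh z hz θ e).symm, ht⟩
  · intro h hh M hM hle
    exact hPM h hh M hM fun θ => hle _ (hζ h hh θ) θ (hζK h hh θ)

section

/-! ### The vector product -/

theorem cross_add (a b c : E3) : cross a (b + c) = cross a b + cross a c := by
  simp [cross]

theorem add_cross (a b c : E3) : cross (a + b) c = cross a c + cross b c := by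
  simp [cross]

theorem cross_smul (k : ℝ) (a b : E3) : cross a (k • b) = k • cross a b := by
  simp [cross]

theorem smul_cross (k : ℝ) (a b : E3) : cross (k • a) b = k • cross a b := by
  simp [cross]

theorem cross_self (a : E3) : cross a a = 0 := by
  simp [cross]

theorem cross_anticomm (a b : E3) : cross b a = -cross a b := by
  rw [cross, cross, ← _root_.cross_anticomm a.ofLp b.ofLp, WithLp.toLp_neg]

theorem inner_eq_sum (a b : E3) : inner ℝ a b = a 0 * b 0 + a 1 * b 1 + a 2 * b 2 := by
  simp [PiLp.inner_apply, Fin.sum_univ_three, mul_comm]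

theorem norm_sq_eq_sum (a : E3) : ‖a‖ ^ 2 = a 0 ^ 2 + a 1 ^ 2 + a 2 ^ 2 := by
  rw [← real_inner_self_eq_norm_sq, inner_eq_sum]; ring

theorem cross_apply_zero (a b : E3) : cross a b 0 = a 1 * b 2 - a 2 * b 1 := by
  simp [cross, cross_apply]

theorem cross_apply_one (a b : E3) : cross a b 1 = a 2 * b 0 - a 0 * b 2 := by
  simp [cross, cross_apply]

theorem cross_apply_two (a b : E3) : cross a b 2 = a 0 * b 1 - a 1 * b 0 := by
  simp [cross, cross_apply]

theorem ext3 {a b : E3} (h0 : a 0 = b 0) (h1 : a 1 = b 1) (h2 : a 2 = b 2) : a = b := by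
  ext i; fin_cases i <;> assumption

/-! ### Polar coordinates on the sphere -/

/-- An orthonormal frame of space, of orientation `ε`. -/
structure IsFrame (ε : ℝ) (p e₁ e₂ : E3) : Prop where
  orthonormal : Orthonormal ℝ ![p, e₁, e₂]
  cross_zero_one : cross p e₁ = ε • e₂
  cross_one_two : cross e₁ e₂ = ε • p
  cross_two_zero : cross e₂ p = ε • e₁

theorem orthonormal_vec3_iff {a b c : E3} : Orthonormal ℝ ![a, b, c] ↔
    (‖a‖ = 1 ∧ ‖b‖ = 1 ∧ ‖c‖ = 1) ∧ inner ℝ a b = 0 ∧ inner ℝ a c = 0 ∧ inner ℝ b c = 0 := by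
  constructor
  · intro h
    exact ⟨⟨h.1 0, h.1 1, h.1 2⟩, h.2 (i := 0) (j := 1) (by decide),
      h.2 (i := 0) (j := 2) (by decide), h.2 (i := 1) (j := 2) (by decide)⟩
  · rintro ⟨⟨h1, h2, h3⟩, h4, h5, h6⟩
    refine ⟨fun i => by fin_cases i <;> assumption, fun i j hij => ?_⟩
    fin_cases i <;> fin_cases j <;>
      simp_all [real_inner_comm]

theorem exists_unit_orthogonal (p : E3) : ∃ e : E3, ‖e‖ = 1 ∧ inner ℝ p e = 0 := by
  have key : ∃ w : E3, w ≠ 0 ∧ inner ℝ p w = 0 := by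
    by_cases h : p 0 = 0
    · refine ⟨!₂[1, 0, 0], fun e => ?_, by simp [inner_eq_sum, h]⟩
      simpa using congrArg (fun v : E3 => v 0) e
    · refine ⟨!₂[-p 1, p 0, 0], fun e => h ?_, by simp [inner_eq_sum]; ring⟩
      simpa using congrArg (fun v : E3 => v 1) e
  obtain ⟨w, hw, ho⟩ := key
  refine ⟨‖w‖⁻¹ • w, norm_smul_inv_norm (𝕜 := ℝ) hw, ?_⟩
  rw [inner_smul_right, ho, mul_zero]

/-- The sign ε is left free so that the polar angle can be oriented to increase along the flow,
whether the energy grows or falls towards the pole. -/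
theorem exists_frame {p : E3} (hp : ‖p‖ = 1) {ε : ℝ} (hε : ε ^ 2 = 1) :
    ∃ e₁ e₂, IsFrame ε p e₁ e₂ := by
  obtain ⟨e, he, ho⟩ := exists_unit_orthogonal p
  have hp2 := norm_sq_eq_sum p
  have he2 := norm_sq_eq_sum e
  rw [hp] at hp2
  rw [he] at he2
  rw [inner_eq_sum] at ho
  refine ⟨e, ε • cross p e, ?_, ?_, ?_, ?_⟩
  · rw [orthonormal_vec3_iff]
    refine ⟨⟨hp, he, ?_⟩, by rwa [inner_eq_sum], ?_, ?_⟩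
    · have : ‖ε • cross p e‖ ^ 2 = 1 := by
        rw [norm_smul, mul_pow, norm_sq_eq_sum, Real.norm_eq_abs, sq_abs, hε, cross_apply_zero,
          cross_apply_one, cross_apply_two]
        linear_combination (-1) * (e 0 ^ 2 + e 1 ^ 2 + e 2 ^ 2) * hp2 - he2 -
          (p 0 * e 0 + p 1 * e 1 + p 2 * e 2) * ho
      exact (pow_eq_one_iff_of_nonneg (norm_nonneg _) two_ne_zero).1 this
    · rw [inner_smul_right, inner_eq_sum, cross_apply_zero, cross_apply_one, cross_apply_two]; ring
    · rw [inner_smul_right, inner_eq_sum, cross_apply_zero, cross_apply_one, cross_apply_two]; ring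
  · rw [smul_smul, ← sq, hε, one_smul]
  · rw [cross_smul]
    congr 1
    apply ext3 <;> simp only [cross_apply_zero, cross_apply_one, cross_apply_two]
    · linear_combination (-p 0) * he2 - e 0 * ho
    · linear_combination (-p 1) * he2 - e 1 * ho
    · linear_combination (-p 2) * he2 - e 2 * ho
  · rw [smul_cross]
    congr 1
    apply ext3 <;> simp only [cross_apply_zero, cross_apply_one, cross_apply_two]
    · linear_combination (-e 0) * hp2 - p 0 * ho
    · linear_combination (-e 1) * hp2 - p 1 * ho
    · linear_combination (-e 2) * hp2 - p 2 * ho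

/-- The unit vector in the direction of the polar angle `θ`. -/
def radial (e₁ e₂ : E3) (θ : ℝ) : E3 := cos θ • e₁ + sin θ • e₂

/-- The point of the sphere at height `z` above the equator of the pole `p`, at polar angle `θ`. -/
def polar (p e₁ e₂ : E3) (z θ : ℝ) : E3 := z • p + √(1 - z ^ 2) • radial e₁ e₂ θ

/-- The derivative of `polar` with respect to the height. -/
def polarZ (p e₁ e₂ : E3) (z θ : ℝ) : E3 := p - (z / √(1 - z ^ 2)) • radial e₁ e₂ θ

/-- The derivative of `polar` with respect to the angle. -/
def polarθ (e₁ e₂ : E3) (z θ : ℝ) : E3 := √(1 - z ^ 2) • ((-sin θ) • e₁ + cos θ • e₂)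

theorem one_sub_sq_pos {z : ℝ} (h0 : 0 ≤ z) (h1 : z < 1) : 0 < 1 - z ^ 2 := by nlinarith

theorem hasFDerivAt_polar (p e₁ e₂ : E3) {z : ℝ} (h : 0 < 1 - z ^ 2) (θ : ℝ) :
    HasFDerivAt (fun q : ℝ × ℝ => polar p e₁ e₂ q.1 q.2)
      ((ContinuousLinearMap.fst ℝ ℝ ℝ).smulRight (polarZ p e₁ e₂ z θ) +
        (ContinuousLinearMap.snd ℝ ℝ ℝ).smulRight (polarθ e₁ e₂ z θ)) (z, θ) := by
  have h1 : HasFDerivAt (fun q : ℝ × ℝ => q.1) (ContinuousLinearMap.fst ℝ ℝ ℝ) (z, θ) :=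
    hasFDerivAt_fst
  have h2 : HasFDerivAt (fun q : ℝ × ℝ => q.2) (ContinuousLinearMap.snd ℝ ℝ ℝ) (z, θ) :=
    hasFDerivAt_snd
  have hr : HasDerivAt (fun z : ℝ => √(1 - z ^ 2)) (-(z / √(1 - z ^ 2))) z := by
    have := ((hasDerivAt_pow 2 z).const_sub 1).sqrt h.ne'
    convert this using 1
    have := (Real.sqrt_pos.2 h).ne'
    field_simp
    simp [mul_comm]
  have hn : HasDerivAt (radial e₁ e₂) ((-sin θ) • e₁ + cos θ • e₂) θ :=
    ((hasDerivAt_cos θ).smul_const e₁).add ((hasDerivAt_sin θ).smul_const e₂)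
  have hr' := hr.hasFDerivAt.comp (z, θ) h1
  have hn' := hn.hasFDerivAt.comp (z, θ) h2
  have := (h1.smul_const p).add (hr'.smul hn')
  refine this.congr_fderiv ?_
  apply ContinuousLinearMap.ext
  rintro ⟨a, b⟩
  simp [polarZ, polarθ]
  module

variable {ε : ℝ} {p e₁ e₂ : E3}

theorem IsFrame.eq_sum (hF : IsFrame ε p e₁ e₂) (u : E3) :
    u = inner ℝ p u • p + inner ℝ e₁ u • e₁ + inner ℝ e₂ u • e₂ := by
  have hs : ⊤ ≤ Submodule.span ℝ (range ![p, e₁, e₂]) := by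
    rw [hF.orthonormal.linearIndependent.span_eq_top_of_card_eq_finrank (by simp)]
  have := (OrthonormalBasis.mk hF.orthonormal hs).sum_repr' u
  simpa [Fin.sum_univ_three] using this.symm

theorem IsFrame.norm_sq (hF : IsFrame ε p e₁ e₂) (a b c : ℝ) :
    ‖a • p + b • e₁ + c • e₂‖ ^ 2 = a ^ 2 + b ^ 2 + c ^ 2 := by
  obtain ⟨⟨h1, h2, h3⟩, h4, h5, h6⟩ := orthonormal_vec3_iff.1 hF.orthonormal
  have h4' := h4
  have h5' := h5
  have h6' := h6
  rw [real_inner_comm] at h4' h5' h6'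
  rw [← real_inner_self_eq_norm_sq]
  simp only [inner_add_left, inner_add_right, inner_smul_left, inner_smul_right, h4, h5, h6, h4',
    h5', h6', real_inner_self_eq_norm_sq, h1, h2, h3]
  simp
  ring

theorem polar_eq (p e₁ e₂ : E3) (z θ : ℝ) : polar p e₁ e₂ z θ =
    z • p + (√(1 - z ^ 2) * cos θ) • e₁ + (√(1 - z ^ 2) * sin θ) • e₂ := by
  simp only [polar, radial]; module

theorem IsFrame.norm_polar (hF : IsFrame ε p e₁ e₂) {z : ℝ} (h : 0 ≤ 1 - z ^ 2) (θ : ℝ) :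
    ‖polar p e₁ e₂ z θ‖ = 1 := by
  have : ‖polar p e₁ e₂ z θ‖ ^ 2 = 1 := by
    rw [polar_eq, hF.norm_sq, mul_pow, mul_pow, Real.sq_sqrt h]
    linear_combination (1 - z ^ 2) * Real.sin_sq_add_cos_sq θ
  exact (pow_eq_one_iff_of_nonneg (norm_nonneg _) two_ne_zero).1 this

theorem IsFrame.inner_polar (hF : IsFrame ε p e₁ e₂) (z θ : ℝ) :
    inner ℝ p (polar p e₁ e₂ z θ) = z := by
  obtain ⟨⟨h1, h2, h3⟩, h4, h5, h6⟩ := orthonormal_vec3_iff.1 hF.orthonormal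
  rw [polar_eq]
  simp [inner_add_right, inner_smul_right, h1, h4, h5]

theorem IsFrame.inner_polar_one (hF : IsFrame ε p e₁ e₂) (z θ : ℝ) :
    inner ℝ e₁ (polar p e₁ e₂ z θ) = √(1 - z ^ 2) * cos θ := by
  obtain ⟨⟨h1, h2, h3⟩, h4, h5, h6⟩ := orthonormal_vec3_iff.1 hF.orthonormal
  rw [polar_eq]
  rw [real_inner_comm] at h4
  simp [inner_add_right, inner_smul_right, h2, h4, h6]

theorem IsFrame.inner_polar_two (hF : IsFrame ε p e₁ e₂) (z θ : ℝ) :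
    inner ℝ e₂ (polar p e₁ e₂ z θ) = √(1 - z ^ 2) * sin θ := by
  obtain ⟨⟨h1, h2, h3⟩, h4, h5, h6⟩ := orthonormal_vec3_iff.1 hF.orthonormal
  rw [polar_eq]
  rw [real_inner_comm] at h5 h6
  simp [inner_add_right, inner_smul_right, h3, h5, h6]

theorem exists_angle {a b r : ℝ} (hr : 0 < r) (h : a ^ 2 + b ^ 2 = r ^ 2) :
    ∃ θ, a = r * cos θ ∧ b = r * sin θ := by
  have hn : ‖(⟨a, b⟩ : ℂ)‖ = r := by
    rw [Complex.norm_eq_sqrt_sq_add_sq, h, Real.sqrt_sq hr.le]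
  refine ⟨Complex.arg ⟨a, b⟩, ?_, ?_⟩
  · have := Complex.norm_mul_cos_arg ⟨a, b⟩
    rw [hn] at this; exact this.symm
  · have := Complex.norm_mul_sin_arg ⟨a, b⟩
    rw [hn] at this; exact this.symm

theorem IsFrame.exists_polar (hF : IsFrame ε p e₁ e₂) {u : E3} (hu : ‖u‖ = 1)
    (h : 0 < 1 - inner ℝ p u ^ 2) : ∃ θ, u = polar p e₁ e₂ (inner ℝ p u) θ := by
  have h1 := hF.eq_sum u
  have h2 := hF.norm_sq (inner ℝ p u) (inner ℝ e₁ u) (inner ℝ e₂ u)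
  rw [← h1, hu] at h2
  obtain ⟨θ, ha, hb⟩ := exists_angle (a := inner ℝ e₁ u) (b := inner ℝ e₂ u)
    (Real.sqrt_pos.2 h) (by rw [Real.sq_sqrt h.le]; linarith)
  exact ⟨θ, by rw [polar_eq, ← ha, ← hb]; exact h1⟩

/-- Archimedes' theorem in infinitesimal form: dz ∧ dθ is the area form, so u' = G × u reads z' = -ε
∂E/∂θ, θ' = ε ∂E/∂z when G is the gradient of E. -/
theorem IsFrame.velocity (hF : IsFrame ε p e₁ e₂) {z : ℝ} (h : 0 < 1 - z ^ 2) (θ : ℝ) (G : E3) :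
    (-(ε * inner ℝ G (polarθ e₁ e₂ z θ))) • polarZ p e₁ e₂ z θ +
      (ε * inner ℝ G (polarZ p e₁ e₂ z θ)) • polarθ e₁ e₂ z θ =
    cross G (polar p e₁ e₂ z θ) := by
  obtain ⟨⟨h1, h2, h3⟩, h4, h5, h6⟩ := orthonormal_vec3_iff.1 hF.orthonormal
  have c1 := hF.cross_zero_one
  have c2 := hF.cross_one_two
  have c3 := hF.cross_two_zero
  have c1' := cross_anticomm p e₁
  have c2' := cross_anticomm e₁ e₂
  have c3' := cross_anticomm e₂ p
  rw [c1] at c1'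
  rw [c2] at c2'
  rw [c3] at c3'
  have i1 : inner ℝ G (polarZ p e₁ e₂ z θ) =
      inner ℝ p G - (z / √(1 - z ^ 2)) * (cos θ * inner ℝ e₁ G + sin θ * inner ℝ e₂ G) := by
    simp only [polarZ, radial, inner_sub_right, inner_add_right, inner_smul_right,
      real_inner_comm]
  have i2 : inner ℝ G (polarθ e₁ e₂ z θ) =
      √(1 - z ^ 2) * (-sin θ * inner ℝ e₁ G + cos θ * inner ℝ e₂ G) := by
    simp only [polarθ, inner_add_right, inner_smul_right, real_inner_comm]
  rw [i1, i2]
  conv_rhs => rw [hF.eq_sum G, polar_eq]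
  generalize inner ℝ p G = a
  generalize inner ℝ e₁ G = b
  generalize inner ℝ e₂ G = c
  simp only [cross_add, add_cross, cross_smul, smul_cross, c1, c2, c3, c1', c2', c3', cross_self,
    polarZ, polarθ, radial]
  have hr := Real.sqrt_pos.2 h
  have hr2 := Real.sq_sqrt h.le
  set r := √(1 - z ^ 2)
  have hsc := Real.sin_sq_add_cos_sq θ
  match_scalars
  · field_simp; ring
  · field_simp
    linear_combination (ε * c * z) * hsc
  · field_simp
    linear_combination (-ε * b * z) * hsc

/-- The level curves near the pole `p` of a function `E` on the sphere with gradient `G` that is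
strictly monotone along the meridians of `p`, as orbits of `u' = (1/12) G(u) × u`. -/
theorem exists_loops {E : E3 → ℝ} {G : E3 → E3} {z₀ : ℝ} {I : Set ℝ}
    (hε : ε ^ 2 = 1) (hF : IsFrame ε p e₁ e₂) (hz₀ : 0 ≤ z₀)
    (hE : ∀ z ∈ Ioo z₀ 1, ∀ θ,
      HasFDerivAt E (innerSL ℝ (G (polar p e₁ e₂ z θ))) (polar p e₁ e₂ z θ))
    (hG : ∀ z ∈ Ioo z₀ 1, ∀ θ, ContinuousAt G (polar p e₁ e₂ z θ))
    (hpos : ∀ z ∈ Ioo z₀ 1, ∀ θ,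
      0 < ε * inner ℝ (G (polar p e₁ e₂ z θ)) (polarZ p e₁ e₂ z θ))
    (hI : ∀ h ∈ I, ∀ θ, ∃ z ∈ Ioo z₀ 1, E (polar p e₁ e₂ z θ) = h) :
    ∃ (γ : ℝ → ℝ → E3) (P : ℝ → ℝ),
      (∀ h ∈ I, ∀ t, HasDerivAt (γ h) ((1 / 12 : ℝ) • cross (G (γ h t)) (γ h t)) t) ∧
      (∀ h ∈ I, ∀ t, ‖γ h t‖ = 1 ∧ inner ℝ p (γ h t) ∈ Ioo z₀ 1 ∧ E (γ h t) = h) ∧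
      (∀ h ∈ I, IsLoopAround (γ h) (P h) p) ∧
      ContinuousOn (fun x : ℝ × ℝ => γ x.1 x.2) (I ×ˢ univ) ∧ ContinuousOn P I ∧
      (∀ h ∈ I, ∀ u, ‖u‖ = 1 → inner ℝ p u ∈ Ioo z₀ 1 → E u = h → u ∈ range (γ h)) ∧
      ∀ h ∈ I, ∀ M > 0, (∀ z ∈ Ioo z₀ 1, ∀ θ, E (polar p e₁ e₂ z θ) = h →
        M ≤ ε * inner ℝ (G (polar p e₁ e₂ z θ)) (polarZ p e₁ e₂ z θ)) →
        P h ≤ 2 * π / (M / 12) := by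
  have hε0 : ε ≠ 0 := by rintro rfl; norm_num at hε
  have hsq : ∀ z ∈ Ioo z₀ 1, 0 < 1 - z ^ 2 := fun z hz => one_sub_sq_pos (hz₀.trans hz.1.le) hz.2
  have hpol : ContinuousOn (fun q : ℝ × ℝ => polar p e₁ e₂ q.1 q.2) (Ioo z₀ 1 ×ˢ univ) := by
    unfold polar radial; fun_prop
  have hpolZ : ContinuousOn (fun q : ℝ × ℝ => polarZ p e₁ e₂ q.1 q.2) (Ioo z₀ 1 ×ˢ univ) := by
    unfold polarZ radial
    refine ContinuousOn.sub continuousOn_const (ContinuousOn.smul (ContinuousOn.div continuousOn_fst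
      (by fun_prop) fun q hq => (Real.sqrt_pos.2 (hsq _ hq.1)).ne') (by fun_prop))
  have hper : ∀ z θ, polar p e₁ e₂ z (θ + 2 * π) = polar p e₁ e₂ z θ := by
    intro z θ; simp [polar, radial]
  have hperZ : ∀ z θ, polarZ p e₁ e₂ z (θ + 2 * π) = polarZ p e₁ e₂ z θ := by
    intro z θ; simp [polarZ, radial]
  -- The Hamiltonian is εE/12: the sign makes it increase with z, and 1/12 is the factor in the
  -- reduced equation.
  obtain ⟨Z, T, P, hZ, hZd, hTd, hZc, hTc, hPc, hP0, hTP, hZP, hTm, hsurj, hPM⟩ :=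
    exists_level_flow (z₀ := z₀) (I := I) (c := fun h => ε / 12 * h)
      (K := fun z θ => ε / 12 * E (polar p e₁ e₂ z θ))
      (Kz := fun z θ => ε / 12 * inner ℝ (G (polar p e₁ e₂ z θ)) (polarZ p e₁ e₂ z θ))
      (Kθ := fun z θ => ε / 12 * inner ℝ (G (polar p e₁ e₂ z θ)) (polarθ e₁ e₂ z θ))
      (by
        intro z hz θ
        have h1 := ((hE z hz θ).comp (z, θ) (hasFDerivAt_polar p e₁ e₂ (hsq z hz) θ)).const_mul
          (ε / 12)
        refine h1.congr_fderiv ?_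
        apply ContinuousLinearMap.ext
        rintro ⟨a, b⟩
        simp
        ring)
      (fun z hz θ => by have := hpos z hz θ; linarith)
      (by
        refine continuousOn_const.mul (ContinuousOn.inner (𝕜 := ℝ) ?_ hpolZ)
        intro q hq
        exact (hG q.1 hq.1 q.2).comp_continuousWithinAt
          (f := fun q : ℝ × ℝ => polar p e₁ e₂ q.1 q.2) (hpol q hq))
      (fun z θ => by rw [hper]) (fun z θ => by rw [hper, hperZ]) (by fun_prop)
      (fun h hh θ => by
        obtain ⟨z, hz, e⟩ := hI h hh θ
        exact ⟨z, hz, by rw [e]⟩)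
  have hE' : ∀ h ∈ I, ∀ t, E (polar p e₁ e₂ (Z h t) (T h t)) = h := fun h hh t =>
    mul_left_cancel₀ (div_ne_zero hε0 (by norm_num)) (hZ h hh t).2
  have hγd : ∀ h ∈ I, ∀ t, HasDerivAt (fun t => polar p e₁ e₂ (Z h t) (T h t))
      ((1 / 12 : ℝ) • cross (G (polar p e₁ e₂ (Z h t) (T h t)))
        (polar p e₁ e₂ (Z h t) (T h t))) t := by
    intro h hh t
    have h1 := (hasFDerivAt_polar p e₁ e₂ (hsq _ (hZ h hh t).1) (T h t)).comp_hasDerivAt t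
      ((hZd h hh t).prodMk (hTd h hh t))
    rw [← hF.velocity (hsq _ (hZ h hh t).1)]
    refine h1.congr_deriv ?_
    simp
    module
  refine ⟨fun h t => polar p e₁ e₂ (Z h t) (T h t), P, hγd, ?_, ?_, ?_, hPc, ?_, ?_⟩
  · intro h hh t
    refine ⟨hF.norm_polar (hsq _ (hZ h hh t).1).le _, ?_, hE' h hh t⟩
    rw [hF.inner_polar]
    exact (hZ h hh t).1
  · intro h hh
    have hTc' : Continuous (T h) :=
      continuous_iff_continuousAt.2 fun t => (hTd h hh t).continuousAt
    refine ⟨continuous_iff_continuousAt.2 fun t => (hγd h hh t).continuousAt,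
      fun t => hF.norm_polar (hsq _ (hZ h hh t).1).le _, hP0 h hh, ?_, ?_, ?_⟩
    · intro t
      simp only [hTP h hh, hZP h hh, hper]
    · intro s hs t ht hst
      have ez : Z h s = Z h t := by
        have := congrArg (inner ℝ p) hst
        simpa only [hF.inner_polar] using this
      have hr := (Real.sqrt_pos.2 (hsq _ (hZ h hh t).1)).ne'
      have ec : cos (T h s) = cos (T h t) := by
        have := congrArg (inner ℝ e₁) hst
        simp only [hF.inner_polar_one, ez] at this
        exact mul_left_cancel₀ hr this
      have es : sin (T h s) = sin (T h t) := by
        have := congrArg (inner ℝ e₂) hst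
        simp only [hF.inner_polar_two, ez] at this
        exact mul_left_cancel₀ hr this
      apply (hTm h hh).injective
      -- During one period the angles stay in a half-open interval of length 2π, so angles congruent
      -- modulo 2π coincide.
      have hbd : ∀ x ∈ Ico 0 (P h), T h 0 ≤ T h x ∧ T h x < T h 0 + 2 * π := by
        intro x hx
        refine ⟨(hTm h hh).monotone hx.1, ?_⟩
        rw [← hTP h hh, zero_add]
        exact hTm h hh hx.2
      obtain ⟨n, hn⟩ := Real.Angle.angle_eq_iff_two_pi_dvd_sub.1
        (Real.Angle.cos_sin_inj ec es)
      have b1 := hbd s hs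
      have b2 := hbd t ht
      have hn0 : n = 0 := by
        have l1 : (n : ℝ) < 1 := by
          by_contra hc
          nlinarith [Real.pi_pos]
        have l2 : (-1 : ℝ) < n := by
          by_contra hc
          nlinarith [Real.pi_pos]
        have l1' : n < 1 := by exact_mod_cast l1
        have l2' : -1 < n := by exact_mod_cast l2
        omega
      rw [hn0] at hn
      simp at hn
      linarith
    · exact ⟨e₁, e₂, hF.orthonormal, Z h, fun t => √(1 - Z h t ^ 2), T h, hTc',
        fun t => hz₀.trans_lt (hZ h hh t).1.1, fun t => Real.sqrt_pos.2 (hsq _ (hZ h hh t).1),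
        fun t => polar_eq _ _ _ _ _, hTP h hh⟩
  · exact hpol.comp (hZc.prodMk hTc) fun x hx => ⟨(hZ _ hx.1 _).1, mem_univ _⟩
  · intro h hh u hu hz e
    obtain ⟨θ, hθ⟩ := hF.exists_polar hu (hsq _ hz)
    obtain ⟨t, h1, h2⟩ := hsurj h hh _ hz θ (by rw [← hθ, e])
    exact ⟨t, by simp only [h1, h2]; exact hθ.symm⟩
  · intro h hh M hM hle
    refine hPM h hh (M / 12) (by positivity) fun z hz θ e => ?_
    have := hle z hz θ (mul_left_cancel₀ (div_ne_zero hε0 (by norm_num)) e)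
    linarith

end

/-! ### The elements of the tetrahedral group -/

/-- The sign changes of an even number of coordinates. -/
def evenSigns : Fin 4 → Fin 3 → ℤ := ![![1, 1, 1], ![1, -1, -1], ![-1, 1, -1], ![-1, -1, 1]]

/-- The matrix of a cyclic permutation of the coordinates followed by an even sign change. -/
def tetMatrix (k : Fin 4 × Fin 3) : Matrix (Fin 3) (Fin 3) ℤ :=
  Matrix.of fun r c => if c = r + k.2 then evenSigns k.1 r else 0

/-- Integer entries turn the group laws into finite checks; the results are transported to ℝ by the
cast homomorphism. -/
theorem tetMatrix_mul_transpose : ∀ k, tetMatrix k * (tetMatrix k).transpose = 1 := by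
  decide +kernel

theorem tetMatrix_det : ∀ k, (tetMatrix k).det = 1 := by
  intro k
  rw [Matrix.det_fin_three]
  revert k
  decide +kernel

theorem exists_tetMatrix_mul : ∀ k l, ∃ m, tetMatrix k * tetMatrix l = tetMatrix m := by
  decide +kernel

theorem exists_tetMatrix_inv : ∀ k, ∃ l, tetMatrix k * tetMatrix l = 1 := by
  decide +kernel

theorem tetMatrix_injective : Function.Injective tetMatrix := by
  have : ∀ k l, tetMatrix k = tetMatrix l → k = l := by decide +kernel
  exact fun k l => this k l

/-- The element of `SO(3)` with matrix `tetMatrix k`. -/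
def tetElt (k : Fin 4 × Fin 3) : SO3 :=
  ⟨(tetMatrix k).map (Int.castRingHom ℝ), by
    rw [Matrix.mem_specialOrthogonalGroup_iff, Matrix.mem_orthogonalGroup_iff]
    constructor
    · rw [← Matrix.transpose_map, ← Matrix.map_mul, tetMatrix_mul_transpose, Matrix.map_one] <;> simp
    · rw [← RingHom.mapMatrix_apply, ← RingHom.map_det, tetMatrix_det, map_one]⟩

theorem tetElt_injective : Function.Injective tetElt := by
  intro k l h
  apply tetMatrix_injective
  have := congrArg Subtype.val h
  exact Matrix.map_injective (RingHom.injective_int (Int.castRingHom ℝ)) this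

theorem tetElt_zero : tetElt (0, 0) = 1 := by
  apply Subtype.ext
  have : tetMatrix (0, 0) = 1 := by decide +kernel
  simp [tetElt, this]

theorem tetElt_mul {k l m : Fin 4 × Fin 3} (h : tetMatrix k * tetMatrix l = tetMatrix m) :
    tetElt k * tetElt l = tetElt m := by
  apply Subtype.ext
  simp only [tetElt, ← h, Matrix.map_mul]
  rfl

theorem tetElt_gen : tetElt (0, 1) = genA ∧ tetElt (1, 0) = genB := by
  constructor <;> apply Subtype.ext <;> ext i j <;> fin_cases i <;> fin_cases j <;>
    simp [tetElt, tetMatrix, genA, genB, evenSigns]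

/-- The group of the rotations `tetElt k`. -/
def tetSubgroup : Subgroup SO3 where
  carrier := range tetElt
  mul_mem' := by
    rintro _ _ ⟨k, rfl⟩ ⟨l, rfl⟩
    obtain ⟨m, hm⟩ := exists_tetMatrix_mul k l
    exact ⟨m, (tetElt_mul hm).symm⟩
  one_mem' := ⟨_, tetElt_zero⟩
  inv_mem' := by
    rintro _ ⟨k, rfl⟩
    obtain ⟨l, hl⟩ := exists_tetMatrix_inv k
    refine ⟨l, eq_inv_of_mul_eq_one_right ?_⟩
    rw [← tetElt_zero]
    exact tetElt_mul (by rw [hl]; decide +kernel)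

theorem tetElt_mem (k : Fin 4 × Fin 3) : tetElt k ∈ tetGroup := by
  have hA : tetElt (0, 1) ∈ tetGroup := by
    rw [tetElt_gen.1]; exact Subgroup.subset_closure (by simp)
  have hB : tetElt (1, 0) ∈ tetGroup := by
    rw [tetElt_gen.2]; exact Subgroup.subset_closure (by simp)
  have h0 : tetElt (0, 0) ∈ tetGroup := by rw [tetElt_zero]; exact one_mem _
  have mul : ∀ {k l m}, tetMatrix k * tetMatrix l = tetMatrix m → tetElt k ∈ tetGroup →
      tetElt l ∈ tetGroup → tetElt m ∈ tetGroup := fun h hk hl => by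
    rw [← tetElt_mul h]; exact mul_mem hk hl
  have hA2 : tetElt (0, 2) ∈ tetGroup :=
    mul (k := (0, 1)) (l := (0, 1)) (by decide +kernel) hA hA
  have hBA : tetElt (1, 1) ∈ tetGroup :=
    mul (k := (1, 0)) (l := (0, 1)) (by decide +kernel) hB hA
  have hBA2 : tetElt (1, 2) ∈ tetGroup :=
    mul (k := (1, 0)) (l := (0, 2)) (by decide +kernel) hB hA2
  -- This is the conjugate A B A⁻¹, since A² = A⁻¹; multiplying it by B gives the remaining diagonal
  -- element.
  have hD : tetElt (3, 0) ∈ tetGroup :=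
    mul (k := (0, 1)) (l := (1, 2)) (by decide +kernel) hA hBA2
  have hC : tetElt (2, 0) ∈ tetGroup :=
    mul (k := (1, 0)) (l := (3, 0)) (by decide +kernel) hB hD
  have hrot : ∀ i, tetElt (0, i) ∈ tetGroup := by
    intro i; fin_cases i <;> assumption
  have hdiag : ∀ d, tetElt (d, 0) ∈ tetGroup := by
    intro d; fin_cases d <;> assumption
  have hprod : ∀ k : Fin 4 × Fin 3, tetMatrix (k.1, 0) * tetMatrix (0, k.2) = tetMatrix k := by
    decide +kernel
  exact mul (hprod k) (hdiag _) (hrot _)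

theorem mem_tetGroup_iff {x : SO3} : x ∈ tetGroup ↔ ∃ k, tetElt k = x := by
  constructor
  · intro h
    have hle : tetGroup ≤ tetSubgroup := by
      rw [tetGroup, Subgroup.closure_le]
      rintro y (rfl | rfl)
      · exact ⟨_, tetElt_gen.1⟩
      · exact ⟨_, tetElt_gen.2⟩
    exact hle h
  · rintro ⟨k, rfl⟩
    exact tetElt_mem k

/-- The enumeration of the tetrahedral group by `tetElt`. -/
def tetEquiv : Fin 4 × Fin 3 ≃ tetGroup :=
  Equiv.ofBijective (fun k => ⟨tetElt k, tetElt_mem k⟩)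
    ⟨fun _ _ h => tetElt_injective (congrArg Subtype.val h), fun x => by
      obtain ⟨k, hk⟩ := mem_tetGroup_iff.1 x.2
      exact ⟨k, Subtype.ext hk⟩⟩

theorem tetEquiv_coe (k : Fin 4 × Fin 3) : (tetEquiv k : SO3) = tetElt k := rfl

theorem card_tetGroup : Nat.card tetGroup = 12 := by
  rw [← Nat.card_congr tetEquiv]
  simp

/-! ### The action on space -/

theorem rot_mul (A B : SO3) (u : E3) : rot (A * B) u = rot A (rot B u) := by
  simp [rot, Matrix.mulVec_mulVec]

theorem rot_one (u : E3) : rot 1 u = u := by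
  simp [rot]

theorem rot_add (A : SO3) (u v : E3) : rot A (u + v) = rot A u + rot A v := by
  simp [rot, Matrix.mulVec_add]

theorem rot_smul (A : SO3) (c : ℝ) (u : E3) : rot A (c • u) = c • rot A u := by
  simp [rot, Matrix.mulVec_smul]

theorem rot_inv_rot (A : SO3) (u : E3) : rot A⁻¹ (rot A u) = u := by
  rw [← rot_mul, inv_mul_cancel, rot_one]

theorem rot_inner (A : SO3) (u v : E3) : inner ℝ (rot A u) (rot A v) = inner ℝ u v := by
  have h := (Matrix.mem_orthogonalGroup_iff' (Fin 3) ℝ).1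
    (Matrix.mem_specialOrthogonalGroup_iff.1 A.2).1
  rw [EuclideanSpace.inner_eq_star_dotProduct, EuclideanSpace.inner_eq_star_dotProduct]
  simp only [rot, star_trivial]
  rw [Matrix.dotProduct_mulVec, ← Matrix.mulVec_transpose, Matrix.mulVec_mulVec]
  rw [h, Matrix.one_mulVec]

theorem rot_norm (A : SO3) (u : E3) : ‖rot A u‖ = ‖u‖ := by
  rw [norm_eq_sqrt_real_inner, rot_inner, ← norm_eq_sqrt_real_inner]

/-- The action of a rotation, as a continuous linear map. -/
def rotL (A : SO3) : E3 →L[ℝ] E3 :=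
  LinearMap.toContinuousLinearMap
    { toFun := rot A, map_add' := rot_add A, map_smul' := rot_smul A }

theorem rot_sub (A : SO3) (u v : E3) : rot A (u - v) = rot A u - rot A v := (rotL A).map_sub u v

theorem rot_sum (A : SO3) {ι : Type*} (s : Finset ι) (f : ι → E3) :
    rot A (∑ i ∈ s, f i) = ∑ i ∈ s, rot A (f i) := map_sum (rotL A) f s

theorem rot_tetElt (k : Fin 4 × Fin 3) (u : E3) (j : Fin 3) :
    rot (tetElt k) u j = evenSigns k.1 j * u (j + k.2) := by
  simp [rot, tetElt, tetMatrix, Matrix.mulVec, dotProduct]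

theorem rot_tetElt_cross (k : Fin 4 × Fin 3) (u v : E3) :
    rot (tetElt k) (cross u v) = cross (rot (tetElt k) u) (rot (tetElt k) v) := by
  obtain ⟨d, i⟩ := k
  apply ext3 <;> simp only [rot_tetElt, cross_apply_zero, cross_apply_one, cross_apply_two] <;>
    fin_cases d <;> fin_cases i <;>
    simp [evenSigns, cross_apply_zero, cross_apply_one, cross_apply_two,
      show (1 : Fin 3) + 2 = 0 from rfl, show (2 : Fin 3) + 2 = 1 from rfl,
      show (2 : Fin 3) + 1 = 0 from rfl, show (1 : Fin 3) + 1 = 2 from rfl] <;> ring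

theorem rot_cross (A : tetGroup) (u v : E3) : rot A (cross u v) = cross (rot A u) (rot A v) := by
  obtain ⟨k, hk⟩ := mem_tetGroup_iff.1 A.2
  rw [← hk]
  exact rot_tetElt_cross k u v

/-! ### Sums over pairs of vortices -/

/-- Left translation by the inverse of `g j` permutes the group, so sums over all vortices, as seen
from vortex j, depend neither on j nor on the ordering. -/
theorem sum_rho {M : Type*} [AddCommMonoid M] (g : Fin 12 ≃ tetGroup) (j : Fin 12)
    (f : SO3 → M) : ∑ i, f ((g j : SO3)⁻¹ * g i) = ∑ k, f (tetElt k) := by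
  let e : Fin 12 ≃ Fin 4 × Fin 3 := (g.trans (Equiv.mulLeft (g j)⁻¹)).trans tetEquiv.symm
  refine Fintype.sum_equiv e _ _ fun i => ?_
  rw [← tetEquiv_coe]
  simp [e]

theorem rho_eq (g : Fin 12 ≃ tetGroup) (u : E3) (i j : Fin 12) :
    rho g u i = rot (g j) (rot ((g j : SO3)⁻¹ * g i) u) := by
  rw [← rot_mul, mul_inv_cancel_left]; rfl

theorem norm_rho_sub (g : Fin 12 ≃ tetGroup) (u : E3) (i j : Fin 12) :
    ‖rho g u j - rho g u i‖ = ‖u - rot ((g j : SO3)⁻¹ * g i) u‖ := by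
  rw [rho_eq g u i j, rho, ← rot_sub, rot_norm]

theorem field_rho (g : Fin 12 ≃ tetGroup) (u : E3) (j : Fin 12) :
    field (rho g u) j = rot (g j) (∑ k, (‖u - rot (tetElt k) u‖ ^ 2)⁻¹ •
      cross (rot (tetElt k) u) u) := by
  rw [← sum_rho g j fun A => (‖u - rot A u‖ ^ 2)⁻¹ • cross (rot A u) u, rot_sum, field]
  -- The omitted term i = j may be restored, as its vector product vanishes.
  rw [Finset.sum_erase]
  · refine Finset.sum_congr rfl fun i _ => ?_
    rw [norm_rho_sub, rot_smul, rot_cross, rho_eq g u i j]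
    rfl
  · rw [cross_self, smul_zero]

theorem sum_filter_lt {N : ℕ} (f : Fin N → Fin N → ℝ) (hs : ∀ i j, f i j = f j i)
    (hd : ∀ i, f i i = 0) :
    ∑ p ∈ Finset.univ.filter (fun p : Fin N × Fin N => p.1 < p.2), f p.1 p.2 =
      1 / 2 * ∑ j, ∑ i, f i j := by
  have h1 : ∑ p ∈ Finset.univ.filter (fun p : Fin N × Fin N => p.1 < p.2), f p.1 p.2 =
      ∑ p ∈ Finset.univ.filter (fun p : Fin N × Fin N => p.2 < p.1), f p.1 p.2 :=
    Finset.sum_equiv (Equiv.prodComm _ _) (by simp) fun p _ => hs _ _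
  have h2 : ∑ j, ∑ i, f i j = ∑ p : Fin N × Fin N, f p.1 p.2 := by
    rw [Fintype.sum_prod_type_right]
  have h3 : ∑ p : Fin N × Fin N, f p.1 p.2 =
      ∑ p ∈ Finset.univ.filter (fun p : Fin N × Fin N => p.1 < p.2), f p.1 p.2 +
      ∑ p ∈ Finset.univ.filter (fun p : Fin N × Fin N => p.2 < p.1), f p.1 p.2 := by
    rw [Finset.sum_filter, Finset.sum_filter, ← Finset.sum_add_distrib]
    refine Finset.sum_congr rfl fun p _ => ?_
    rcases lt_trichotomy p.1 p.2 with h | h | h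
    · simp [h, h.not_gt]
    · simp [h, hd]
    · simp [h, h.not_gt]
  rw [h2, h3, ← h1]; ring

/-- The factor is -1/2 (from H) times 1/2 (unordered pairs) times 12 (equal sums). The identity
contributes `Real.log 0 = 0`. -/
theorem H_rho (g : Fin 12 ≃ tetGroup) (u : E3) :
    H (rho g u) = -3 * ∑ k, Real.log (‖u - rot (tetElt k) u‖ ^ 2) := by
  rw [H, sum_filter_lt fun i j => Real.log (‖rho g u j - rho g u i‖ ^ 2)]
  · have : ∀ j, ∑ i, Real.log (‖rho g u j - rho g u i‖ ^ 2) =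
        ∑ k, Real.log (‖u - rot (tetElt k) u‖ ^ 2) := fun j => by
      rw [← sum_rho g j fun A => Real.log (‖u - rot A u‖ ^ 2)]
      exact Finset.sum_congr rfl fun i _ => by rw [norm_rho_sub]
    simp only [this, Finset.sum_const, Finset.card_univ, Fintype.card_fin, nsmul_eq_mul]
    push_cast
    ring
  · intro i j
    rw [norm_sub_rev]
  · simp

/-- Moving the starting point by an element of 𝕋 only relabels the vortices; hence the energy is
𝕋-invariant. -/
theorem rho_rot (g : Fin 12 ≃ tetGroup) (A : tetGroup) (u : E3) :
    rho g (rot A u) = rho (g.trans (Equiv.mulRight A)) u := by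
  funext j
  simp [rho, rot_mul]

theorem H_rho_rot (g : Fin 12 ≃ tetGroup) (A : tetGroup) (u : E3) :
    H (rho g (rot A u)) = H (rho g u) := by
  rw [rho_rot, H_rho, H_rho]

/-! ### The reduced energy -/

/-- Vectors along the axes of the rotations in the tetrahedral group. -/
def axis : Fin 7 → E3 :=
  ![!₂[1, 0, 0], !₂[0, 1, 0], !₂[0, 0, 1], !₂[1, 1, 1], !₂[1, 1, -1], !₂[1, -1, 1], !₂[-1, 1, 1]]

/-- The squared length of `axis i`. -/
def axisSq : Fin 7 → ℝ := ![1, 1, 1, 3, 3, 3, 3]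

/-- The number of nontrivial rotations about `axis i`. -/
def axisMult : Fin 7 → ℝ := ![1, 1, 1, 2, 2, 2, 2]

/-- The contribution of the axes in `s` to the energy of `rho g u`. -/
def partEnergy (s : Finset (Fin 7)) (u : E3) : ℝ :=
  -3 * ∑ i ∈ s, axisMult i * Real.log (axisSq i - inner ℝ (axis i) u ^ 2)

/-- The gradient of `partEnergy s`. -/
def partGrad (s : Finset (Fin 7)) (u : E3) : E3 :=
  ∑ i ∈ s, (6 * axisMult i * inner ℝ (axis i) u / (axisSq i - inner ℝ (axis i) u ^ 2)) • axis i

/-- The points of the unit ball, and beyond, at which the axes in `s` cause no singularity. -/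
def regular (s : Finset (Fin 7)) : Set E3 := {u | ∀ i ∈ s, 0 < axisSq i - inner ℝ (axis i) u ^ 2}

/-- The energy of `rho g u`, as a function of the unit vector `u`. -/
def energy (u : E3) : ℝ := partEnergy Finset.univ u - 9 * Real.log 4

/-- The gradient of `energy`. -/
def grad (u : E3) : E3 := partGrad Finset.univ u

theorem hasFDerivAt_partEnergy {s : Finset (Fin 7)} {u : E3} (hu : u ∈ regular s) :
    HasFDerivAt (partEnergy s) (innerSL ℝ (partGrad s u)) u := by
  have h1 : ∀ i ∈ s, HasFDerivAt
      (fun u : E3 => axisMult i * Real.log (axisSq i - inner ℝ (axis i) u ^ 2))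
      (axisMult i • ((axisSq i - inner ℝ (axis i) u ^ 2)⁻¹ •
        -((2 * inner ℝ (axis i) u) • innerSL ℝ (axis i)))) u := by
    intro i hi
    have h2 : HasFDerivAt (fun u : E3 => inner ℝ (axis i) u) (innerSL ℝ (axis i)) u :=
      (innerSL ℝ (axis i)).hasFDerivAt
    have h3 := ((h2.pow 2).const_sub (axisSq i)).log (hu i hi).ne'
    simpa using h3.const_mul (axisMult i)
  have h2 := (HasFDerivAt.fun_sum h1).const_mul (-3 : ℝ)
  refine h2.congr_fderiv ?_
  rw [partGrad, map_sum, Finset.smul_sum]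
  refine Finset.sum_congr rfl fun i _ => ?_
  rw [map_smul]
  match_scalars
  ring

theorem isOpen_regular (s : Finset (Fin 7)) : IsOpen (regular s) := by
  have : regular s = ⋂ i ∈ s, {u | 0 < axisSq i - inner ℝ (axis i) u ^ 2} := by
    ext u; simp [regular]
  rw [this]
  exact isOpen_biInter_finset fun i _ => isOpen_lt continuous_const (by fun_prop)

theorem continuousAt_partGrad {s : Finset (Fin 7)} {u : E3} (hu : u ∈ regular s) :
    ContinuousAt (partGrad s) u := by
  unfold partGrad
  refine tendsto_finsetSum _ fun i hi => ?_
  have : ContinuousAt (fun u : E3 => 6 * axisMult i * inner ℝ (axis i) u /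
      (axisSq i - inner ℝ (axis i) u ^ 2)) u :=
    ContinuousAt.div (by fun_prop) (by fun_prop) (hu i hi).ne'
  exact this.smul continuousAt_const

theorem hasFDerivAt_energy {u : E3} (hu : u ∈ regular Finset.univ) :
    HasFDerivAt energy (innerSL ℝ (grad u)) u :=
  (hasFDerivAt_partEnergy hu).sub_const _

/-- The squared displacements of a unit vector under the rotations of the tetrahedral group. -/
theorem norm_sub_rot_sq {u : E3} (hu : ‖u‖ = 1) (k : Fin 4 × Fin 3) :
    ‖u - rot (tetElt k) u‖ ^ 2 =
      ![![0, 3 - inner ℝ (axis 3) u ^ 2, 3 - inner ℝ (axis 3) u ^ 2],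
        ![4 * (1 - inner ℝ (axis 0) u ^ 2), 3 - inner ℝ (axis 4) u ^ 2,
          3 - inner ℝ (axis 5) u ^ 2],
        ![4 * (1 - inner ℝ (axis 1) u ^ 2), 3 - inner ℝ (axis 6) u ^ 2,
          3 - inner ℝ (axis 4) u ^ 2],
        ![4 * (1 - inner ℝ (axis 2) u ^ 2), 3 - inner ℝ (axis 5) u ^ 2,
          3 - inner ℝ (axis 6) u ^ 2]] k.1 k.2 := by
  -- The factor 4 sin²(α/2) is 4 for the half-turns and 3 for the third-turns; the latter is
  -- absorbed by axes of squared length 3.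
  have h := norm_sq_eq_sum u
  rw [hu, one_pow] at h
  have h0 : u 0 ^ 2 = 1 - u 1 ^ 2 - u 2 ^ 2 := by linarith
  obtain ⟨d, i⟩ := k
  rw [norm_sq_eq_sum]
  simp only [PiLp.sub_apply, rot_tetElt]
  fin_cases d <;> fin_cases i <;>
    simp [evenSigns, axis, inner_eq_sum, show (1 : Fin 3) + 2 = 0 from rfl,
      show (2 : Fin 3) + 2 = 1 from rfl, show (2 : Fin 3) + 1 = 0 from rfl,
      show (1 : Fin 3) + 1 = 2 from rfl] <;> ring_nf <;> simp only [h0] <;> ring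

theorem regular_univ_iff {u : E3} : u ∈ regular Finset.univ ↔
    0 < 1 - inner ℝ (axis 0) u ^ 2 ∧ 0 < 1 - inner ℝ (axis 1) u ^ 2 ∧
    0 < 1 - inner ℝ (axis 2) u ^ 2 ∧ 0 < 3 - inner ℝ (axis 3) u ^ 2 ∧
    0 < 3 - inner ℝ (axis 4) u ^ 2 ∧ 0 < 3 - inner ℝ (axis 5) u ^ 2 ∧
    0 < 3 - inner ℝ (axis 6) u ^ 2 := by
  simp [regular, Fin.forall_fin_succ, axisSq]

/-- The constant 9 log 4 collects the factors 4 of the three half-turns, each weighted by 3. -/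
theorem H_rho_eq_energy (g : Fin 12 ≃ tetGroup) {u : E3} (hu : ‖u‖ = 1)
    (hr : u ∈ regular Finset.univ) : H (rho g u) = energy u := by
  obtain ⟨h0, h1, h2, h3, h4, h5, h6⟩ := regular_univ_iff.1 hr
  rw [H_rho, energy, partEnergy]
  simp only [norm_sub_rot_sq hu, Fintype.sum_prod_type, Fin.sum_univ_four, Fin.sum_univ_three,
    Fin.sum_univ_seven]
  simp [axisSq, axisMult, Real.log_mul, h0.ne', h1.ne', h2.ne']
  ring

theorem rot_ne_self {u : E3} (hu : ‖u‖ = 1) (hr : u ∈ regular Finset.univ) {k : Fin 4 × Fin 3}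
    (hk : k ≠ (0, 0)) : rot (tetElt k) u ≠ u := by
  obtain ⟨h0, h1, h2, h3, h4, h5, h6⟩ := regular_univ_iff.1 hr
  intro e
  have := norm_sub_rot_sq hu k
  rw [e, sub_self, norm_zero] at this
  obtain ⟨d, i⟩ := k
  fin_cases d <;> fin_cases i <;> simp at this hk <;> linarith

theorem rho_injective (g : Fin 12 ≃ tetGroup) {u : E3} (hu : ‖u‖ = 1)
    (hr : u ∈ regular Finset.univ) : Function.Injective (rho g u) := by
  intro i j hij
  obtain ⟨k, hk⟩ := mem_tetGroup_iff.1 ((g j)⁻¹ * g i).2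
  have e : rot (tetElt k) u = u := by
    rw [hk]
    rw [rho_eq g u i j, rho] at hij
    have := congrArg (rot (g j : SO3)⁻¹) hij
    rwa [rot_inv_rot, rot_inv_rot] at this
  by_cases h : k = (0, 0)
  · rw [h, tetElt_zero] at hk
    have : (g j)⁻¹ * g i = 1 := Subtype.ext hk.symm
    exact g.injective (inv_mul_eq_one.1 this).symm
  · exact absurd e (rot_ne_self hu hr h)

/-- Group the rotations by axis a. A half-turn sends u to 2⟨a,u⟩a - u; for third-turns the images
under R and R⁻¹ add up to ⟨a,u⟩a - u, with |a|² = 3. After the product with u only a multiple of a ×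
u survives, and it is 1/12 of the gradient term of that axis. -/
theorem sum_cross_eq {u : E3} (hu : ‖u‖ = 1) :
    ∑ k, (‖u - rot (tetElt k) u‖ ^ 2)⁻¹ • cross (rot (tetElt k) u) u =
      (1 / 12 : ℝ) • cross (grad u) u := by
  simp only [norm_sub_rot_sq hu, Fintype.sum_prod_type, Fin.sum_univ_four, Fin.sum_univ_three,
    grad, partGrad, Fin.sum_univ_seven, div_eq_mul_inv]
  simp only [axisSq, axisMult, Matrix.cons_val, mul_inv]
  -- With the inverse distances as free variables, a polynomial identity remains, linear in each of
  -- them.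
  generalize (1 - inner ℝ (axis 0) u ^ 2)⁻¹ = q0
  generalize (1 - inner ℝ (axis 1) u ^ 2)⁻¹ = q1
  generalize (1 - inner ℝ (axis 2) u ^ 2)⁻¹ = q2
  generalize (3 - inner ℝ (axis 3) u ^ 2)⁻¹ = q3
  generalize (3 - inner ℝ (axis 4) u ^ 2)⁻¹ = q4
  generalize (3 - inner ℝ (axis 5) u ^ 2)⁻¹ = q5
  generalize (3 - inner ℝ (axis 6) u ^ 2)⁻¹ = q6
  apply ext3 <;>
  simp only [PiLp.add_apply, PiLp.smul_apply, smul_eq_mul, cross_apply_zero, cross_apply_one,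
      cross_apply_two, rot_tetElt, inner_eq_sum] <;>
    simp [evenSigns, axis, show (1 : Fin 3) + 2 = 0 from rfl,
      show (2 : Fin 3) + 2 = 1 from rfl, show (2 : Fin 3) + 1 = 0 from rfl,
      show (1 : Fin 3) + 1 = 2 from rfl] <;> ring

theorem field_rho_eq (g : Fin 12 ≃ tetGroup) {u : E3} (hu : ‖u‖ = 1) (j : Fin 12) :
    field (rho g u) j = rot (g j) ((1 / 12 : ℝ) • cross (grad u) u) := by
  rw [field_rho, sum_cross_eq hu]

section

/-! ### Families of periodic solutions around the orbit of a pole -/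

variable {ε : ℝ} {p e₁ e₂ : E3}

theorem IsLoopAround.map_rot (A : SO3) {γ : ℝ → E3} {P : ℝ} (h : IsLoopAround γ P p) :
    IsLoopAround (fun t => rot A (γ t)) P (rot A p) := by
  have hinj : Function.Injective (rot A) := fun x y e => by
    have := congrArg (rot A⁻¹) e
    rwa [rot_inv_rot, rot_inv_rot] at this
  refine ⟨(rotL A).continuous.comp h.continuous, fun t => by rw [rot_norm, h.on_sphere], h.pos,
    fun t => by simp only [h.periodic t], fun s hs t ht e => h.simple hs ht (hinj e), ?_⟩
  obtain ⟨e₁, e₂, ho, z, r, θ, hθ, hz, hr, hγ, hp⟩ := h.around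
  refine ⟨rot A e₁, rot A e₂, ?_, z, r, θ, hθ, hz, hr, fun t => ?_, hp⟩
  · rw [orthonormal_vec3_iff] at ho ⊢
    simpa only [rot_norm, rot_inner] using ho
  · rw [hγ, rot_add, rot_add, rot_smul, rot_smul, rot_smul]

theorem norm_sub_sq_of_unit {a b : E3} (ha : ‖a‖ = 1) (hb : ‖b‖ = 1) :
    ‖a - b‖ ^ 2 = 2 - 2 * inner ℝ b a := by
  rw [norm_sub_sq_real, ha, hb, real_inner_comm]; ring

theorem rho_norm (g : Fin 12 ≃ tetGroup) (u : E3) (j : Fin 12) : ‖rho g u j‖ = ‖u‖ :=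
  rot_norm _ _

/-- Since `g 0 = 1`, vortex 0 runs along the loop supplied by `exists_loops` and the others along
its images. The hypothesis `hsep` says that the caps above height z₀ around distinct points of the
orbit are disjoint. -/
theorem exists_periodicFamily (g : Fin 12 ≃ tetGroup) (hg : g 0 = 1) {z₀ : ℝ} {I : Set ℝ}
    (hε : ε ^ 2 = 1) (hF : IsFrame ε p e₁ e₂) (hz₀ : 0 ≤ z₀)
    (hreg : ∀ z ∈ Ioo z₀ 1, ∀ θ, polar p e₁ e₂ z θ ∈ regular Finset.univ)
    (hpos : ∀ z ∈ Ioo z₀ 1, ∀ θ,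
      0 < ε * inner ℝ (grad (polar p e₁ e₂ z θ)) (polarZ p e₁ e₂ z θ))
    (hI : ∀ h ∈ I, ∀ θ, ∃ z ∈ Ioo z₀ 1, energy (polar p e₁ e₂ z θ) = h)
    (hsep : ∀ i j, rho g p i ≠ rho g p j → ∀ u, ‖u‖ = 1 → z₀ < inner ℝ (rho g p i) u →
      ¬ z₀ < inner ℝ (rho g p j) u) :
    ∃ (v : ℝ → ℝ → Fin 12 → E3) (P : ℝ → ℝ),
      IsPeriodicFamily g (rho g p) I v P ∧
      (∀ h ∈ I, ∀ t j, ∃ z ∈ Ioo z₀ 1, ∃ θ, energy (polar p e₁ e₂ z θ) = h ∧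
        ‖v h t j - rho g p j‖ ^ 2 = 2 - 2 * z) ∧
      ∀ h ∈ I, ∀ M > 0, (∀ z ∈ Ioo z₀ 1, ∀ θ, energy (polar p e₁ e₂ z θ) = h →
        M ≤ ε * inner ℝ (grad (polar p e₁ e₂ z θ)) (polarZ p e₁ e₂ z θ)) →
        P h ≤ 2 * π / (M / 12) := by
  obtain ⟨γ, P, hγd, hγ, hloop, hγc, hPc, hrange, hPM⟩ := exists_loops hε hF hz₀
    (fun z hz θ => hasFDerivAt_energy (hreg z hz θ))
    (fun z hz θ => continuousAt_partGrad (hreg z hz θ)) hpos hI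
  have hpn : ‖p‖ = 1 := hF.orthonormal.1 0
  have hregu : ∀ u, ‖u‖ = 1 → inner ℝ p u ∈ Ioo z₀ 1 → u ∈ regular Finset.univ := by
    intro u hu hz
    obtain ⟨θ, hθ⟩ := hF.exists_polar hu (one_sub_sq_pos (hz₀.trans hz.1.le) hz.2)
    rw [hθ]
    exact hreg _ hz θ
  have hγr : ∀ h ∈ I, ∀ t, γ h t ∈ regular Finset.univ := fun h hh t =>
    hregu _ (hγ h hh t).1 (hγ h hh t).2.1
  have hrot0 : ∀ u, rho g u 0 = u := fun u => by simp [rho, hg, rot_one]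
  refine ⟨fun h t => rho g (γ h t), P, ?_, ?_, hPM⟩
  · refine ⟨?_, ?_, ?_, ?_, ?_, hPc, ?_, ?_, ?_⟩
    · intro h hh
      refine ⟨fun t j => by rw [rho_norm, (hγ h hh t).1],
        fun t => rho_injective g (hγ h hh t).1 (hγr h hh t), fun t j => ?_⟩
      rw [field_rho_eq g (hγ h hh t).1]
      exact (rotL (g j)).hasFDerivAt.comp_hasDerivAt t (hγd h hh t)
    · intro h hh t
      rw [hrot0]
    · intro h hh t
      rw [H_rho_eq_energy g (hγ h hh t).1 (hγr h hh t), (hγ h hh t).2.2]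
    · intro h hh
      refine ⟨⟨(hloop h hh).pos, fun t => by simp only [(hloop h hh).periodic t]⟩, ?_⟩
      rintro s ⟨hs, hper⟩
      -- A shorter period would make vortex 0 revisit a point of its simple loop too early.
      by_contra hlt
      rw [not_le] at hlt
      have h1 := congrFun (hper 0) 0
      simp only [hrot0, zero_add] at h1
      exact hs.ne' ((hloop h hh).simple ⟨hs.le, hlt⟩ ⟨le_rfl, (hloop h hh).pos⟩ h1)
    · exact continuousOn_pi.2 fun j => (rotL (g j)).continuous.comp_continuousOn hγc
    · intro h hh j
      exact (hloop h hh).map_rot (g j)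
    · have hsub : ∀ h ∈ I, ∀ i j, rho g p i = rho g p j →
          range (fun t => rho g (γ h t) i) ⊆ range (fun t => rho g (γ h t) j) := by
        rintro h hh i j hij _ ⟨t, rfl⟩
        -- This element of the stabiliser of p preserves height and energy, so it maps the level
        -- curve, which is all of the loop, to itself.
        have hk : rot ((g j)⁻¹ * g i : tetGroup) p = p := by
          have := congrArg (rot (g j : SO3)⁻¹) hij
          rw [rho_eq g p i j, rot_inv_rot] at this
          rw [rho, rot_inv_rot] at this
          exact this
        set A : tetGroup := (g j)⁻¹ * g i with hA
        have hz : inner ℝ p (rot A (γ h t)) = inner ℝ p (γ h t) := by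
          conv_lhs => rw [← hk, rot_inner]
        have hn : ‖rot A (γ h t)‖ = 1 := by rw [rot_norm, (hγ h hh t).1]
        have hz' : inner ℝ p (rot A (γ h t)) ∈ Ioo z₀ 1 := by rw [hz]; exact (hγ h hh t).2.1
        obtain ⟨s, hs⟩ := hrange h hh _ hn hz' (by
          rw [← H_rho_eq_energy g hn (hregu _ hn hz'), H_rho_rot,
            H_rho_eq_energy g (hγ h hh t).1 (hγr h hh t), (hγ h hh t).2.2])
        refine ⟨s, ?_⟩
        simp only [hs]
        rw [rho_eq g (γ h t) i j]
        rfl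
      exact fun h hh i j hij => (hsub h hh i j hij).antisymm (hsub h hh j i hij.symm)
    · intro h hh i j hij
      rw [Set.disjoint_left]
      rintro _ ⟨t, rfl⟩ ⟨s, hs⟩
      have hi : inner ℝ (rho g p i) (rho g (γ h t) i) = inner ℝ p (γ h t) := rot_inner _ _ _
      have hj : inner ℝ (rho g p j) (rho g (γ h s) j) = inner ℝ p (γ h s) := rot_inner _ _ _
      refine hsep i j hij (rho g (γ h t) i) (by rw [rho_norm, (hγ h hh t).1]) ?_ ?_
      · rw [hi]; exact (hγ h hh t).2.1.1
      · simp only at hs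
        rw [← hs, hj]; exact (hγ h hh s).2.1.1
  · intro h hh t j
    obtain ⟨θ, hθ⟩ := hF.exists_polar (hγ h hh t).1
      (one_sub_sq_pos (hz₀.trans (hγ h hh t).2.1.1.le) (hγ h hh t).2.1.2)
    refine ⟨_, (hγ h hh t).2.1, θ, by rw [← hθ, (hγ h hh t).2.2], ?_⟩
    rw [norm_sub_sq_of_unit (by rw [rho_norm, (hγ h hh t).1]) (by rw [rho_norm, hpn])]
    congr 2
    exact rot_inner _ _ _

/-! ### Separation of caps and levels approaching a pole -/

theorem eventually_separated {v : Fin 12 → E3} (hv : ∀ j, ‖v j‖ = 1) :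
    ∀ᶠ z in 𝓝[<] (1 : ℝ), ∀ i j, v i ≠ v j → ∀ u, ‖u‖ = 1 → z < inner ℝ (v i) u →
      ¬ z < inner ℝ (v j) u := by
  rw [eventually_all]; intro i
  rw [eventually_all]; intro j
  by_cases hij : v i = v j
  · simp [hij]
  have hd : 0 < ‖v i - v j‖ ^ 2 := by
    have := norm_pos_iff.2 (sub_ne_zero.2 hij); positivity
  -- Above this height a point is closer to the pole than half the distance of the two poles, so the
  -- triangle inequality excludes a common point.
  have : ∀ᶠ z in 𝓝[<] (1 : ℝ), 1 - ‖v i - v j‖ ^ 2 / 8 < z :=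
    eventually_nhdsWithin_of_eventually_nhds (eventually_gt_nhds (by linarith))
  filter_upwards [this] with z hz _ u hu h1 h2
  have e1 := norm_sub_sq_of_unit hu (hv i)
  have e2 := norm_sub_sq_of_unit hu (hv j)
  have e3 : ‖v i - v j‖ ≤ ‖u - v i‖ + ‖u - v j‖ := by
    rw [norm_sub_rev u (v i)]; exact norm_sub_le_norm_sub_add_norm_sub _ _ _
  nlinarith [norm_nonneg (v i - v j), sq_nonneg (‖u - v i‖ - ‖u - v j‖),
    norm_nonneg (u - v i), norm_nonneg (u - v j)]

/-- Only the interior of D has to lie in the strip, so D may contain z = 1, where `polarZ` is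
singular; the comparison with the value at a minimum needs this. -/
theorem strictMonoOn_energy_polar {z₀ : ℝ} (hz₀ : 0 ≤ z₀)
    (hreg : ∀ z ∈ Ioo z₀ 1, ∀ θ, polar p e₁ e₂ z θ ∈ regular Finset.univ)
    (hpos : ∀ z ∈ Ioo z₀ 1, ∀ θ,
      0 < ε * inner ℝ (grad (polar p e₁ e₂ z θ)) (polarZ p e₁ e₂ z θ))
    {D : Set ℝ} (hD : Convex ℝ D) (hDi : interior D ⊆ Ioo z₀ 1) (θ : ℝ)
    (hc : ContinuousOn (fun z => energy (polar p e₁ e₂ z θ)) D) :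
    StrictMonoOn (fun z => ε * energy (polar p e₁ e₂ z θ)) D := by
  refine strictMonoOn_of_deriv_pos hD (continuousOn_const.mul hc) fun z hz => ?_
  have hz := hDi hz
  have h1 : HasDerivAt (fun z : ℝ => (z, θ)) ((1 : ℝ), (0 : ℝ)) z :=
    (hasDerivAt_id z).prodMk (hasDerivAt_const z θ)
  have h2 := (hasFDerivAt_polar p e₁ e₂ (one_sub_sq_pos (hz₀.trans hz.1.le) hz.2)
    θ).comp_hasDerivAt z h1
  have h3 := ((hasFDerivAt_energy (hreg z hz θ)).comp_hasDerivAt z h2).const_mul ε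
  have h4 := h3.deriv
  simp only [Function.comp_def] at h4
  rw [h4]
  simpa using hpos z hz θ

theorem continuous_polar (p e₁ e₂ : E3) :
    Continuous fun q : ℝ × ℝ => polar p e₁ e₂ q.1 q.2 := by
  unfold polar radial; fun_prop

theorem continuousOn_energy : ContinuousOn energy (regular Finset.univ) :=
  fun _ hu => (hasFDerivAt_energy hu).continuousAt.continuousWithinAt

/-- Provides bounds on the energy along a parallel that are uniform in θ. -/
theorem isCompact_range_energy_polar {z : ℝ}
    (hreg : ∀ θ, polar p e₁ e₂ z θ ∈ regular Finset.univ) :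
    IsCompact (range fun θ => energy (polar p e₁ e₂ z θ)) := by
  refine Function.Periodic.compact_of_continuous (c := 2 * π) ?_ (by positivity) ?_
  · intro θ; simp [polar, radial]
  · exact continuousOn_energy.comp_continuous
      ((continuous_polar p e₁ e₂).comp (Continuous.prodMk_right z)) hreg

/-- A family of periodic solutions whose energy levels approach the pole. -/
theorem tendstoUniformly_of_level {g : Fin 12 ≃ tetGroup} {z₀ : ℝ} {I : Set ℝ} {l : Filter ℝ}
    {v : ℝ → ℝ → Fin 12 → E3} (hz₀ : z₀ < 1) (hl : ∀ᶠ h in l, h ∈ I)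
    (hv : ∀ h ∈ I, ∀ t j, ∃ z ∈ Ioo z₀ 1, ∃ θ, energy (polar p e₁ e₂ z θ) = h ∧
        ‖v h t j - rho g p j‖ ^ 2 = 2 - 2 * z)
    (hlev : ∀ z₁ ∈ Ioo z₀ 1, ∀ᶠ h in l, ∀ z ∈ Ioo z₀ 1, ∀ θ,
      energy (polar p e₁ e₂ z θ) = h → z₁ < z) :
    TendstoUniformly v (fun _ => rho g p) l := by
  rw [Metric.tendstoUniformly_iff]
  intro η hη
  -- Above height 1 - η²/4 the squared distance 2 - 2z is below η²/2; the other entry keeps z₁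
  -- inside the strip.
  set z₁ := max ((z₀ + 1) / 2) (1 - η ^ 2 / 4)
  have hz₁ : z₁ ∈ Ioo z₀ 1 := by
    constructor
    · exact lt_of_lt_of_le (by linarith) (le_max_left _ _)
    · exact max_lt (by linarith) (by have : 0 < η ^ 2 := by positivity
                                     linarith)
  filter_upwards [hl, hlev z₁ hz₁] with h hh hlt t
  rw [dist_comm, dist_pi_lt_iff hη]
  intro j
  obtain ⟨z, hz, θ, he, hn⟩ := hv h hh t j
  rw [dist_eq_norm]
  have h1 := hlt z hz θ he
  have h2 : 1 - η ^ 2 / 4 ≤ z₁ := le_max_right _ _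
  refine lt_of_pow_lt_pow_left₀ 2 hη.le ?_
  rw [hn]
  have : 0 < η ^ 2 := by positivity
  linarith

/-- If the energy grows beyond all bounds towards the pole `p`, there is a family of periodic
solutions converging to the collision configuration `rho g p`. -/
theorem convergesToCollision (g : Fin 12 ≃ tetGroup) (hg : g 0 = 1) (hF : IsFrame 1 p e₁ e₂)
    (hreg : ∀ᶠ z in 𝓝[<] (1 : ℝ), ∀ θ, polar p e₁ e₂ z θ ∈ regular Finset.univ)
    (hder : ∀ M : ℝ, ∀ᶠ z in 𝓝[<] (1 : ℝ), ∀ θ,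
      M ≤ inner ℝ (grad (polar p e₁ e₂ z θ)) (polarZ p e₁ e₂ z θ))
    (hlim : ∀ θ, Tendsto (fun z => energy (polar p e₁ e₂ z θ)) (𝓝[<] 1) atTop) :
    ConvergesToCollision g (rho g p) := by
  have hsep := eventually_separated (v := rho g p)
    fun j => by rw [rho_norm]; exact hF.orthonormal.1 0
  have h0 : ∀ᶠ z in 𝓝[<] (1 : ℝ), (0 : ℝ) < z :=
    eventually_nhdsWithin_of_eventually_nhds (eventually_gt_nhds one_pos)
  obtain ⟨y, hy1, hy⟩ := (mem_nhdsLT_iff_exists_Ioo_subset).1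
    (((hreg.and (hder 1)).and hsep).and h0)
  rw [mem_Iio] at hy1
  -- Shrinking the strip makes the separation of caps available at z₀ itself.
  set z₀ := (y + 1) / 2 with hz₀d
  have hz₀ : z₀ ∈ Ioo y 1 := ⟨by linarith, by linarith⟩
  have hz₀0 : 0 ≤ z₀ := (hy hz₀).2.le
  have hsub : Ioo z₀ 1 ⊆ Ioo y 1 := Ioo_subset_Ioo_left hz₀.1.le
  have hreg' : ∀ z ∈ Ioo z₀ 1, ∀ θ, polar p e₁ e₂ z θ ∈ regular Finset.univ :=
    fun z hz => (hy (hsub hz)).1.1.1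
  have hpos' : ∀ z ∈ Ioo z₀ 1, ∀ θ,
      0 < 1 * inner ℝ (grad (polar p e₁ e₂ z θ)) (polarZ p e₁ e₂ z θ) :=
    fun z hz θ => by have := (hy (hsub hz)).1.1.2 θ; linarith
  have hcont : ∀ θ, ContinuousOn (fun z => energy (polar p e₁ e₂ z θ)) (Ioo z₀ 1) := fun θ =>
    continuousOn_energy.comp ((continuous_polar p e₁ e₂).comp
      (Continuous.prodMk_left θ)).continuousOn fun z hz => hreg' z hz θ
  have hmono : ∀ θ, StrictMonoOn (fun z => energy (polar p e₁ e₂ z θ)) (Ioo z₀ 1) := fun θ => by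
    simpa using strictMonoOn_energy_polar hz₀0 hreg' hpos' (convex_Ioo _ _)
      (by rw [interior_Ioo]) θ (hcont θ)
  have hbd : ∀ z ∈ Ioo z₀ 1, ∃ m, ∀ θ, energy (polar p e₁ e₂ z θ) ≤ m := fun z hz => by
    obtain ⟨m, hm⟩ := (isCompact_range_energy_polar (hreg' z hz)).bddAbove
    exact ⟨m, fun θ => hm ⟨θ, rfl⟩⟩
  have hmid : (z₀ + 1) / 2 ∈ Ioo z₀ 1 := ⟨by linarith [hz₀.2], by linarith [hz₀.2]⟩
  -- Every energy above the bound on this middle parallel is attained on each meridian between it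
  -- and the pole.
  obtain ⟨h₁, hh₁⟩ := hbd _ hmid
  have hI : ∀ h ∈ Ioi h₁, ∀ θ, ∃ z ∈ Ioo z₀ 1, energy (polar p e₁ e₂ z θ) = h := by
    intro h hh θ
    obtain ⟨z, hz, hze⟩ := (((hlim θ).eventually_ge_atTop h).and (Ioo_mem_nhdsLT hmid.2)).exists
    have hsubI : Icc ((z₀ + 1) / 2) z ⊆ Ioo z₀ 1 := fun x hx =>
      ⟨hmid.1.trans_le hx.1, hx.2.trans_lt hze.2⟩
    obtain ⟨x, hx, e⟩ := intermediate_value_Icc hze.1.le ((hcont θ).mono hsubI)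
      ⟨(hh₁ θ).trans (le_of_lt hh), hz⟩
    exact ⟨x, hsubI hx, e⟩
  obtain ⟨v, P, hfam, hv, hP⟩ := exists_periodicFamily g hg (by norm_num) hF hz₀0 hreg' hpos' hI
    (hy hz₀).1.2
  have hlev : ∀ z₁ ∈ Ioo z₀ 1, ∀ᶠ h in atTop, ∀ z ∈ Ioo z₀ 1, ∀ θ,
      energy (polar p e₁ e₂ z θ) = h → z₁ < z := by
    intro z₁ hz₁
    obtain ⟨m, hm⟩ := hbd z₁ hz₁
    filter_upwards [eventually_gt_atTop m] with h hmh z hz θ e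
    rw [← (hmono θ).lt_iff_lt hz₁ hz]
    simp only [e]
    exact (hm θ).trans_lt hmh
  refine ⟨h₁, v, P, hfam, tendstoUniformly_of_level hz₀.2 (Ioi_mem_atTop h₁) hv hlev, ?_⟩
  rw [Metric.tendsto_nhds]
  intro η hη
  -- The period is at most 2π/(M/12) = 24π/M, which is then below η.
  set M := 24 * π / η + 1 with hM
  have hM0 : 0 < M := by positivity
  obtain ⟨x, hx1, hx⟩ := (mem_nhdsLT_iff_exists_Ioo_subset).1 (hder M)
  rw [mem_Iio] at hx1
  have hz₁ : max x ((z₀ + 1) / 2) ∈ Ioo z₀ 1 :=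
    ⟨hmid.1.trans_le (le_max_right _ _), max_lt hx1 hmid.2⟩
  filter_upwards [hlev _ hz₁, Ioi_mem_atTop h₁] with h hh hI'
  have hle := hP h hI' M hM0 fun z hz θ e => by
    rw [one_mul]
    exact hx ⟨(le_max_left _ _).trans_lt (hh z hz θ e), hz.2⟩ θ
  have hPpos : 0 < P h := (hfam.period h hI').1.1
  rw [Real.dist_eq, sub_zero, abs_of_pos hPpos]
  refine hle.trans_lt ?_
  rw [div_lt_iff₀ (by positivity)]
  have : η * (M / 12) = 2 * π + η / 12 := by rw [hM]; field_simp; ring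
  linarith

/-- If the energy decreases towards the regular pole `p`, there is a family of periodic solutions
emanating from the configuration `rho g p`. -/
theorem emanatesFrom (g : Fin 12 ≃ tetGroup) (hg : g 0 = 1) (hF : IsFrame (-1) p e₁ e₂)
    (hp : p ∈ regular Finset.univ)
    (hreg : ∀ᶠ z in 𝓝[<] (1 : ℝ), ∀ θ, polar p e₁ e₂ z θ ∈ regular Finset.univ)
    (hder : ∀ᶠ z in 𝓝[<] (1 : ℝ), ∀ θ,
      inner ℝ (grad (polar p e₁ e₂ z θ)) (polarZ p e₁ e₂ z θ) < 0) :
    EmanatesFrom g (rho g p) := by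
  have hpn : ‖p‖ = 1 := hF.orthonormal.1 0
  have hsep := eventually_separated (v := rho g p) fun j => by rw [rho_norm, hpn]
  have h0 : ∀ᶠ z in 𝓝[<] (1 : ℝ), (0 : ℝ) < z :=
    eventually_nhdsWithin_of_eventually_nhds (eventually_gt_nhds one_pos)
  obtain ⟨y, hy1, hy⟩ := (mem_nhdsLT_iff_exists_Ioo_subset).1
    (((hreg.and hder).and hsep).and h0)
  rw [mem_Iio] at hy1
  set z₀ := (y + 1) / 2 with hz₀d
  have hz₀ : z₀ ∈ Ioo y 1 := ⟨by linarith, by linarith⟩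
  have hz₀0 : 0 ≤ z₀ := (hy hz₀).2.le
  have hsub : Ioo z₀ 1 ⊆ Ioo y 1 := Ioo_subset_Ioo_left hz₀.1.le
  have hreg' : ∀ z ∈ Ioo z₀ 1, ∀ θ, polar p e₁ e₂ z θ ∈ regular Finset.univ :=
    fun z hz => (hy (hsub hz)).1.1.1
  have hpos' : ∀ z ∈ Ioo z₀ 1, ∀ θ,
      0 < -1 * inner ℝ (grad (polar p e₁ e₂ z θ)) (polarZ p e₁ e₂ z θ) :=
    fun z hz θ => by have := (hy (hsub hz)).1.1.2 θ; linarith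
  -- All meridians end at p, so monotonicity up to and including z = 1 compares every level with
  -- `energy p`.
  have hpole : ∀ θ, polar p e₁ e₂ 1 θ = p := fun θ => by simp [polar]
  have hcont : ∀ θ, ContinuousOn (fun z => energy (polar p e₁ e₂ z θ)) (Ioc z₀ 1) := fun θ =>
    continuousOn_energy.comp ((continuous_polar p e₁ e₂).comp
      (Continuous.prodMk_left θ)).continuousOn fun z hz => by
        rcases hz.2.eq_or_lt with rfl | hlt
        · simpa only [Function.comp, hpole] using hp
        · exact hreg' z ⟨hz.1, hlt⟩ θ
  have hanti : ∀ θ, StrictAntiOn (fun z => energy (polar p e₁ e₂ z θ)) (Ioc z₀ 1) := fun θ => by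
    have := strictMonoOn_energy_polar hz₀0 hreg' hpos' (convex_Ioc _ _)
      (by rw [interior_Ioc]) θ (hcont θ)
    intro a ha b hb hab
    have := this ha hb hab
    simp only at this ⊢
    linarith
  have hbd : ∀ z ∈ Ioo z₀ 1, ∃ m > energy p, ∀ θ, m ≤ energy (polar p e₁ e₂ z θ) := fun z hz => by
    obtain ⟨_, ⟨θ₀, rfl⟩, hm⟩ := (isCompact_range_energy_polar (hreg' z hz)).exists_isLeast
      (range_nonempty _)
    refine ⟨_, ?_, fun θ => hm ⟨θ, rfl⟩⟩
    have := hanti θ₀ ⟨hz.1, hz.2.le⟩ ⟨hz₀.2, le_rfl⟩ hz.2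
    simpa only [hpole] using this
  have hmid : (z₀ + 1) / 2 ∈ Ioo z₀ 1 := ⟨by linarith [hz₀.2], by linarith [hz₀.2]⟩
  -- All energies strictly between `energy p` and m occur on every meridian; their gap will be δ.
  obtain ⟨m, hm, hmθ⟩ := hbd _ hmid
  have hI : ∀ h ∈ Ioo (energy p) m, ∀ θ, ∃ z ∈ Ioo z₀ 1, energy (polar p e₁ e₂ z θ) = h := by
    intro h hh θ
    have hsubI : Icc ((z₀ + 1) / 2) 1 ⊆ Ioc z₀ 1 := fun x hx => ⟨hmid.1.trans_le hx.1, hx.2⟩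
    obtain ⟨x, hx, e⟩ := intermediate_value_Icc' hmid.2.le ((hcont θ).mono hsubI)
      (show h ∈ Icc _ _ from ⟨by simpa only [hpole] using hh.1.le, hh.2.le.trans (hmθ θ)⟩)
    refine ⟨x, ⟨(hsubI hx).1, lt_of_le_of_ne hx.2 ?_⟩, e⟩
    rintro rfl
    simp only [hpole] at e
    exact hh.1.ne e
  have hH : H (rho g p) = energy p := H_rho_eq_energy g hpn hp
  obtain ⟨v, P, hfam, hv, hP⟩ := exists_periodicFamily g hg (by norm_num) hF hz₀0 hreg' hpos' hI
    (hy hz₀).1.2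
  refine ⟨m - energy p, sub_pos.2 hm, v, P, ?_, ?_⟩
  · rw [hH, add_sub_cancel]
    exact hfam
  rw [hH]
  refine tendstoUniformly_of_level hz₀.2 (Ioo_mem_nhdsGT hm) hv ?_
  intro z₁ hz₁
  obtain ⟨m', hm', hm'θ⟩ := hbd z₁ hz₁
  filter_upwards [Ioo_mem_nhdsGT hm'] with h hh z hz θ e
  by_contra hle
  rw [not_lt] at hle
  have := (hanti θ).antitoneOn ⟨hz.1, hz.2.le⟩ ⟨hz₁.1, hz₁.2.le⟩ hle
  simp only [e] at this
  linarith [hm'θ θ, hh.2]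

end

section

/-! ### The energy near a pole -/

variable {ε : ℝ} {p e₁ e₂ : E3}

theorem IsFrame.norm_pole (hF : IsFrame ε p e₁ e₂) : ‖p‖ = 1 := hF.orthonormal.1 0

theorem IsFrame.inner_radial (hF : IsFrame ε p e₁ e₂) (θ : ℝ) :
    inner ℝ p (radial e₁ e₂ θ) = 0 := by
  obtain ⟨-, h4, h5, -⟩ := orthonormal_vec3_iff.1 hF.orthonormal
  simp [radial, inner_add_right, inner_smul_right, h4, h5]

theorem IsFrame.norm_radial (hF : IsFrame ε p e₁ e₂) (θ : ℝ) : ‖radial e₁ e₂ θ‖ = 1 := by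
  have h := hF.norm_sq 0 (cos θ) (sin θ)
  rw [zero_smul, zero_add, zero_pow two_ne_zero, zero_add, Real.cos_sq_add_sin_sq] at h
  exact (pow_eq_one_iff_of_nonneg (norm_nonneg _) two_ne_zero).1 h

theorem IsFrame.norm_polarZ (hF : IsFrame ε p e₁ e₂) {z : ℝ} (h : 0 < 1 - z ^ 2) (θ : ℝ) :
    ‖polarZ p e₁ e₂ z θ‖ = (√(1 - z ^ 2))⁻¹ := by
  have hr := Real.sqrt_pos.2 h
  have hr2 := Real.sq_sqrt h.le
  rw [← sq_eq_sq₀ (norm_nonneg _) (by positivity), polarZ, norm_sub_sq_real, inner_smul_right,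
    hF.inner_radial, norm_smul, hF.norm_radial, hF.norm_pole, Real.norm_eq_abs, mul_one,
    sq_abs]
  field_simp
  linear_combination hr2

theorem eventually_pos_and_lt_one :
    ∀ᶠ z in 𝓝[<] (1 : ℝ), 1 / 2 < z ∧ z < 1 :=
  (eventually_nhdsWithin_of_eventually_nhds (eventually_gt_nhds (by norm_num))).and
    eventually_mem_nhdsWithin

/-- The squared distance of a parallel from the pole is 2 - 2z, so local properties at p hold
uniformly in θ. -/
theorem IsFrame.eventually_polar_mem (hF : IsFrame ε p e₁ e₂) {U : Set E3} (hU : U ∈ 𝓝 p) :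
    ∀ᶠ z in 𝓝[<] (1 : ℝ), ∀ θ, polar p e₁ e₂ z θ ∈ U := by
  obtain ⟨η, hη, hb⟩ := Metric.mem_nhds_iff.1 hU
  have : ∀ᶠ z in 𝓝[<] (1 : ℝ), 1 - η ^ 2 / 2 < z :=
    eventually_nhdsWithin_of_eventually_nhds
      (eventually_gt_nhds (by have : 0 < η ^ 2 := by positivity
                              linarith))
  filter_upwards [this, eventually_pos_and_lt_one] with z hz h1 θ
  apply hb
  rw [Metric.mem_ball, dist_eq_norm]
  refine lt_of_pow_lt_pow_left₀ 2 hη.le ?_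
  rw [norm_sub_sq_of_unit (hF.norm_polar (one_sub_sq_pos (by linarith) h1.2).le θ)
    hF.norm_pole, hF.inner_polar]
  linarith

theorem tendsto_sqrt_one_sub_sq :
    Tendsto (fun z : ℝ => √(1 - z ^ 2)) (𝓝[<] 1) (𝓝[>] 0) := by
  refine tendsto_nhdsWithin_iff.2 ⟨?_, ?_⟩
  · have : Continuous fun z : ℝ => √(1 - z ^ 2) := by fun_prop
    have h := this.tendsto 1
    simp only [one_pow, sub_self, Real.sqrt_zero] at h
    exact h.mono_left nhdsWithin_le_nhds
  · filter_upwards [eventually_pos_and_lt_one] with z hz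
    exact Real.sqrt_pos.2 (one_sub_sq_pos (by linarith) hz.2)

/-! ### Poles on an axis of rotation -/

theorem axisMult_ge_one (k : Fin 7) : 1 ≤ axisMult k := by
  fin_cases k <;> simp [axisMult]

/-- The singular logarithm depends on z alone. With m = `axisMult k` and q = (1 - z²)^(-1/2), its
z-derivative is 6mzq² ≥ 3q² for z > 1/2. The other terms have bounded gradient and `polarZ` has
length q, so they contribute O(q). Here c is the signed length of the axis along p. -/
theorem convergesToCollision_of_axis (g : Fin 12 ≃ tetGroup) (hg : g 0 = 1) (hp : ‖p‖ = 1) {k : Fin 7} {c : ℝ}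
    (hk : axis k = c • p) (hc : c ^ 2 = axisSq k) (hc0 : c ≠ 0)
    (hr : p ∈ regular (Finset.univ.erase k)) : ConvergesToCollision g (rho g p) := by
  obtain ⟨e₁, e₂, hF⟩ := exists_frame hp (ε := 1) (by norm_num)
  have hin : ∀ z θ, inner ℝ (axis k) (polar p e₁ e₂ z θ) = c * z := fun z θ => by
    rw [hk, real_inner_smul_left, hF.inner_polar]
  have hden : ∀ z, axisSq k - (c * z) ^ 2 = axisSq k * (1 - z ^ 2) := fun z => by
    rw [mul_pow, hc]; ring
  have hsq : 0 < axisSq k := by rw [← hc]; positivity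
  have hregk := hF.eventually_polar_mem ((isOpen_regular _).mem_nhds hr)
  have hm := axisMult_ge_one k
  refine convergesToCollision g hg hF ?_ ?_ ?_
  · filter_upwards [hregk, eventually_pos_and_lt_one] with z hz h1 θ i _
    by_cases hi : i = k
    · rw [hi, hin, hden]
      exact mul_pos hsq (one_sub_sq_pos (by linarith) h1.2)
    · exact hz θ i (Finset.mem_erase.2 ⟨hi, Finset.mem_univ _⟩)
  · intro M
    set C := ‖partGrad (Finset.univ.erase k) p‖ + 1 with hC
    have hbd : ∀ᶠ z in 𝓝[<] (1 : ℝ), ∀ θ,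
        ‖partGrad (Finset.univ.erase k) (polar p e₁ e₂ z θ)‖ < C :=
      hF.eventually_polar_mem ((continuousAt_partGrad hr).norm.eventually_lt continuousAt_const
        (lt_add_one _))
    -- Once q exceeds C, 1 and M, the derivative is at least 3q² - Cq ≥ 2q² ≥ M.
    have hlarge := (tendsto_inv_nhdsGT_zero.comp tendsto_sqrt_one_sub_sq).eventually_ge_atTop
      (max C (max 1 M))
    filter_upwards [hbd, hlarge, eventually_pos_and_lt_one] with z hb hl h1 θ
    have hz2 := one_sub_sq_pos (by linarith) h1.2
    have hdec : grad (polar p e₁ e₂ z θ) =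
        (6 * axisMult k * (c * z) / (axisSq k * (1 - z ^ 2))) • axis k +
          partGrad (Finset.univ.erase k) (polar p e₁ e₂ z θ) := by
      rw [grad, partGrad, ← Finset.add_sum_erase _ _ (Finset.mem_univ k), hin, hden]
      rfl
    have hmain : inner ℝ (axis k) (polarZ p e₁ e₂ z θ) = c := by
      rw [hk, real_inner_smul_left, polarZ, inner_sub_right, inner_smul_right, hF.inner_radial,
        real_inner_self_eq_norm_sq, hp]
      ring
    have hrest := (neg_le_of_abs_le (abs_real_inner_le_norm
      (partGrad (Finset.univ.erase k) (polar p e₁ e₂ z θ)) (polarZ p e₁ e₂ z θ)))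
    rw [hF.norm_polarZ hz2] at hrest
    rw [hdec, inner_add_left, real_inner_smul_left, hmain]
    have e1 : 6 * axisMult k * (c * z) / (axisSq k * (1 - z ^ 2)) * c =
        6 * axisMult k * z * ((√(1 - z ^ 2))⁻¹) ^ 2 := by
      rw [inv_pow, Real.sq_sqrt hz2.le, ← hc]
      field_simp
    rw [e1]
    simp only [Function.comp] at hl
    set q := (√(1 - z ^ 2))⁻¹
    have hq1 : C ≤ q := (le_max_left _ _).trans hl
    have hq2 : 1 ≤ q := (le_max_left _ _).trans ((le_max_right _ _).trans hl)
    have hq3 : M ≤ q := (le_max_right _ _).trans ((le_max_right _ _).trans hl)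
    have e2 : ‖partGrad (Finset.univ.erase k) (polar p e₁ e₂ z θ)‖ * q ≤ q * q :=
      mul_le_mul_of_nonneg_right ((hb θ).le.trans hq1) (by linarith)
    have e3 : 3 * q ^ 2 ≤ 6 * axisMult k * z * q ^ 2 :=
      mul_le_mul_of_nonneg_right (by nlinarith [h1.1]) (by positivity)
    nlinarith
  · intro θ
    have hdec : ∀ z, energy (polar p e₁ e₂ z θ) = partEnergy (Finset.univ.erase k)
        (polar p e₁ e₂ z θ) - 9 * Real.log 4 +
          3 * axisMult k * -Real.log (axisSq k * (1 - z ^ 2)) := fun z => by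
      rw [energy, partEnergy, ← Finset.add_sum_erase _ _ (Finset.mem_univ k), hin, hden, partEnergy]
      ring
    simp only [hdec]
    refine Tendsto.add_atTop (C := partEnergy (Finset.univ.erase k) p - 9 * Real.log 4) ?_ ?_
    · refine Tendsto.sub_const ?_ _
      have h1 : ContinuousAt (partEnergy (Finset.univ.erase k)) (polar p e₁ e₂ 1 θ) := by
        rw [show polar p e₁ e₂ 1 θ = p by simp [polar]]
        exact (hasFDerivAt_partEnergy hr).continuousAt
      have h2 : ContinuousAt (fun z => polar p e₁ e₂ z θ) 1 :=
        ((continuous_polar p e₁ e₂).comp (Continuous.prodMk_left θ)).continuousAt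
      have h3 := (ContinuousAt.comp (f := fun z => polar p e₁ e₂ z θ) h1 h2).tendsto
      simp only [Function.comp_def, show polar p e₁ e₂ 1 θ = p by simp [polar]] at h3
      exact h3.mono_left nhdsWithin_le_nhds
    · refine Tendsto.const_mul_atTop (by positivity) (tendsto_neg_atBot_atTop.comp
        (Real.tendsto_log_nhdsGT_zero.comp ?_))
      refine tendsto_nhdsWithin_iff.2 ⟨?_, ?_⟩
      · have : Continuous fun z : ℝ => axisSq k * (1 - z ^ 2) := by fun_prop
        have h := this.tendsto 1
        simp only [one_pow, sub_self, mul_zero] at h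
        exact h.mono_left nhdsWithin_le_nhds
      · filter_upwards [eventually_pos_and_lt_one] with z hz
        exact mul_pos hsq (one_sub_sq_pos (by linarith) hz.2)

/-! ### Poles at a nondegenerate minimum of the energy -/

/-- Let n be the radial direction and r = √(1 - z²). The product equals ⟨G u, p⟩ - (z/r)⟨G u, n⟩,
where the first term tends to a, and ⟨G u, n⟩ is r⟨A n, n⟩ ≥ r(a + c) up to small errors. The upper
limit is at most -c; subtracting a accounts for the curvature of the sphere. -/
theorem IsFrame.eventually_inner_polarZ_neg (hF : IsFrame ε p e₁ e₂) {G : E3 → E3}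
    {A : E3 →L[ℝ] E3} {a c : ℝ} (hG : HasFDerivAt G A p) (hGp : G p = a • p) (hc : 0 < c)
    (hA : ∀ w, inner ℝ p w = 0 → (a + c) * ‖w‖ ^ 2 ≤ inner ℝ (A w) w) :
    ∀ᶠ z in 𝓝[<] (1 : ℝ), ∀ θ,
      inner ℝ (G (polar p e₁ e₂ z θ)) (polarZ p e₁ e₂ z θ) < 0 := by
  have hpn : ‖p‖ = 1 := hF.norm_pole
  have hη : 0 < c / 4 := by positivity
  have h1 : ∀ᶠ z in 𝓝[<] (1 : ℝ), ∀ θ, ‖G (polar p e₁ e₂ z θ) - G p‖ < c / 4 :=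
    hF.eventually_polar_mem (by
      filter_upwards [Metric.tendsto_nhds.1 hG.continuousAt _ hη] with u hu
      rwa [dist_eq_norm] at hu)
  have h2 : ∀ᶠ z in 𝓝[<] (1 : ℝ), ∀ θ, ‖G (polar p e₁ e₂ z θ) - G p -
      A (polar p e₁ e₂ z θ - p)‖ ≤ c / 4 * ‖polar p e₁ e₂ z θ - p‖ :=
    hF.eventually_polar_mem (Asymptotics.isLittleO_iff.1 hG.isLittleO hη)
  -- The left-hand side tends to a + c/4 - (a + c/2) = -c/4.
  have h3 : ∀ᶠ z in 𝓝[<] (1 : ℝ), a + c / 4 -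
      z * (a + c - c / 4 * 2 - ‖A p‖ * √(1 - z ^ 2)) < 0 := by
    have : Continuous fun z : ℝ => a + c / 4 -
      z * (a + c - c / 4 * 2 - ‖A p‖ * √(1 - z ^ 2)) := by fun_prop
    refine eventually_nhdsWithin_of_eventually_nhds
      (this.continuousAt.eventually_lt continuousAt_const ?_)
    simp
    linarith
  filter_upwards [h1, h2, h3, eventually_pos_and_lt_one] with z g1 g2 g3 hz θ
  replace g1 := g1 θ
  replace g2 := g2 θ
  have hz2 := one_sub_sq_pos (by linarith) hz.2
  have hr := Real.sqrt_pos.2 hz2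
  have hr2 := Real.sq_sqrt hz2.le
  have hu := hF.norm_polar hz2.le θ
  have hd := norm_sub_sq_of_unit hu hpn
  rw [hF.inner_polar] at hd
  have hup : polar p e₁ e₂ z θ - p = (z - 1) • p + √(1 - z ^ 2) • radial e₁ e₂ θ := by
    rw [polar]; module
  have hn := hF.norm_radial θ
  have hpo := hF.inner_radial θ
  have hAn := hA _ hpo
  rw [hn] at hAn
  generalize polar p e₁ e₂ z θ = u at *
  rw [polarZ]
  generalize radial e₁ e₂ θ = n at *
  set r := √(1 - z ^ 2)
  have k1 : inner ℝ (G u) p ≤ a + c / 4 := by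
    have e : inner ℝ (G u) p = inner ℝ (G u - G p) p + a := by
      rw [inner_sub_left, hGp, real_inner_smul_left, real_inner_self_eq_norm_sq, hpn]; ring
    have := (le_abs_self _).trans (abs_real_inner_le_norm (G u - G p) p)
    rw [hpn, mul_one] at this
    linarith
  have k0 : ‖u - p‖ ≤ 2 * r := by
    refine le_of_sq_le_sq ?_ (by positivity)
    rw [hd, mul_pow, hr2]
    nlinarith [hz.1, hz.2]
  -- Expand G at p with u - p = (z - 1)p + rn. The Taylor remainder costs (c/4)·2r, and the pole
  -- component costs r²‖A p‖ because 1 - z ≤ r².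
  have k2 : r * (a + c - c / 4 * 2 - ‖A p‖ * r) ≤ inner ℝ (G u) n := by
    have e : inner ℝ (G u) n = inner ℝ (G u - G p - A (u - p)) n + (z - 1) * inner ℝ (A p) n +
        r * inner ℝ (A n) n := by
      rw [hup, map_add, map_smul, map_smul, inner_sub_left, inner_sub_left, inner_add_left, hGp,
        real_inner_smul_left, real_inner_smul_left, real_inner_smul_left, hpo]
      ring
    have b1 := neg_le_of_abs_le (abs_real_inner_le_norm (G u - G p - A (u - p)) n)
    have b2 := (le_abs_self _).trans (abs_real_inner_le_norm (A p) n)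
    rw [hn, mul_one] at b1 b2
    have b3 : c / 4 * ‖u - p‖ ≤ c / 4 * (2 * r) := by gcongr
    have b4 : (1 - z) * inner ℝ (A p) n ≤ (1 - z) * ‖A p‖ :=
      mul_le_mul_of_nonneg_left b2 (by linarith [hz.2])
    have b5 : (1 - z) * ‖A p‖ ≤ r ^ 2 * ‖A p‖ :=
      mul_le_mul_of_nonneg_right (by rw [hr2]; nlinarith [hz.1, hz.2]) (norm_nonneg _)
    have b6 : r * ((a + c) * 1 ^ 2) ≤ r * inner ℝ (A n) n := mul_le_mul_of_nonneg_left hAn hr.le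
    rw [e]
    nlinarith
  rw [inner_sub_right, inner_smul_right]
  have k3 : z / r * (r * (a + c - c / 4 * 2 - ‖A p‖ * r)) ≤ z / r * inner ℝ (G u) n :=
    mul_le_mul_of_nonneg_left k2 (div_nonneg (by linarith [hz.1]) hr.le)
  have k4 : z / r * (r * (a + c - c / 4 * 2 - ‖A p‖ * r)) =
      z * (a + c - c / 4 * 2 - ‖A p‖ * r) := by field_simp
  linarith

/-- The second derivative of the energy. -/
def hess (u : E3) : E3 →L[ℝ] E3 :=
  ∑ i, (6 * axisMult i * (axisSq i + inner ℝ (axis i) u ^ 2) /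
    (axisSq i - inner ℝ (axis i) u ^ 2) ^ 2) • (innerSL ℝ (axis i)).smulRight (axis i)

theorem hasFDerivAt_grad {u : E3} (hu : u ∈ regular Finset.univ) :
    HasFDerivAt grad (hess u) u := by
  have h1 : ∀ i ∈ Finset.univ, HasFDerivAt (fun u : E3 => (6 * axisMult i * inner ℝ (axis i) u /
      (axisSq i - inner ℝ (axis i) u ^ 2)) • axis i)
      ((6 * axisMult i * (axisSq i + inner ℝ (axis i) u ^ 2) /
        (axisSq i - inner ℝ (axis i) u ^ 2) ^ 2) • (innerSL ℝ (axis i)).smulRight (axis i)) u := by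
    intro i hi
    have h2 : HasFDerivAt (fun u : E3 => inner ℝ (axis i) u) (innerSL ℝ (axis i)) u :=
      (innerSL ℝ (axis i)).hasFDerivAt
    have hne := (hu i hi).ne'
    have h3 : HasDerivAt (fun s : ℝ => 6 * axisMult i * s / (axisSq i - s ^ 2))
        (6 * axisMult i * (axisSq i + inner ℝ (axis i) u ^ 2) /
        (axisSq i - inner ℝ (axis i) u ^ 2) ^ 2) (inner ℝ (axis i) u) := by
      have := ((hasDerivAt_id (inner ℝ (axis i) u)).const_mul (6 * axisMult i)).div
        ((hasDerivAt_pow 2 (inner ℝ (axis i) u)).const_sub (axisSq i)) hne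
      refine this.congr_deriv ?_
      simp only [id, Nat.cast_ofNat]
      ring
    refine ((h3.hasFDerivAt.comp u h2).smul_const (axis i)).congr_fderiv ?_
    apply ContinuousLinearMap.ext
    intro v
    simp [smul_smul, mul_comm]
  exact HasFDerivAt.fun_sum h1

theorem inner_hess (u w : E3) : inner ℝ (hess u w) w =
    ∑ i, 6 * axisMult i * (axisSq i + inner ℝ (axis i) u ^ 2) /
      (axisSq i - inner ℝ (axis i) u ^ 2) ^ 2 * inner ℝ (axis i) w ^ 2 := by
  simp only [hess, sum_apply, sum_inner]
  refine Finset.sum_congr rfl fun i _ => ?_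
  simp only [smul_apply, ContinuousLinearMap.smulRight_apply, innerSL_apply_apply,
    real_inner_smul_left]
  ring

theorem emanatesFrom_of_minimum (g : Fin 12 ≃ tetGroup) (hg : g 0 = 1) (hp : ‖p‖ = 1)
    (hr : p ∈ regular Finset.univ) {a c : ℝ} (hGp : grad p = a • p) (hc : 0 < c)
    (hA : ∀ w, inner ℝ p w = 0 → (a + c) * ‖w‖ ^ 2 ≤ inner ℝ (hess p w) w) :
    EmanatesFrom g (rho g p) := by
  -- Energy falls towards a minimum, so the frame is reversed to make the angle increase.
  obtain ⟨e₁, e₂, hF⟩ := exists_frame hp (ε := -1) (by norm_num)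
  exact emanatesFrom g hg hF hr (hF.eventually_polar_mem ((isOpen_regular _).mem_nhds hr))
    (hF.eventually_inner_polarZ_neg (hasFDerivAt_grad hr) hGp hc hA)

theorem isEquilibrium_rho (g : Fin 12 ≃ tetGroup) (hp : ‖p‖ = 1) (hr : p ∈ regular Finset.univ) {a : ℝ}
    (hGp : grad p = a • p) : IsEquilibrium (rho g p) := by
  refine ⟨fun _ j => by rw [rho_norm, hp], fun _ => rho_injective g hp hr, fun t j => ?_⟩
  rw [field_rho_eq g hp, hGp, smul_cross, cross_self, smul_zero, smul_zero]
  have : rot (g j) 0 = 0 := (rotL (g j)).map_zero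
  rw [this]
  exact hasDerivAt_const _ _

end

/-! ### The vertices of the icosahedron -/

theorem pos_and_inv_eq {d v : ℝ} (hv : 0 < v) (h : d * v = 1) : 0 < d ∧ d⁻¹ = v :=
  ⟨pos_of_mul_pos_left (by rw [h]; exact one_pos) hv.le, inv_eq_of_mul_eq_one_right h⟩

/-- The weights `(axisSq - ⟨axis, p⟩²)⁻¹` at a vertex `p` of the icosahedron whose nonzero
coordinates are `x` and `y`. -/
theorem ico_weights {x y : ℝ} (h1 : x ^ 2 + y ^ 2 = 1) (h2 : 5 * (x ^ 2 * y ^ 2) = 1) :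
    (0 < 1 - x ^ 2 ∧ (1 - x ^ 2)⁻¹ = 5 * x ^ 2) ∧ (0 < 1 - y ^ 2 ∧ (1 - y ^ 2)⁻¹ = 5 * y ^ 2) ∧
    (∀ s, s ^ 2 = (x + y) ^ 2 → 0 < 3 - s ^ 2 ∧ (3 - s ^ 2)⁻¹ = 5 / 8 * (1 + x * y)) ∧
    (∀ s, s ^ 2 = (x - y) ^ 2 → 0 < 3 - s ^ 2 ∧ (3 - s ^ 2)⁻¹ = 5 / 8 * (1 - x * y)) := by
  have hx : x ≠ 0 := by rintro rfl; norm_num at h2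
  have hy : y ≠ 0 := by rintro rfl; norm_num at h2
  refine ⟨pos_and_inv_eq (by positivity) ?_, pos_and_inv_eq (by positivity) ?_,
    fun s hs => pos_and_inv_eq (by nlinarith [sq_nonneg (x + y)]) ?_,
    fun s hs => pos_and_inv_eq (by nlinarith [sq_nonneg (x - y)]) ?_⟩
  -- The reasons are 1 - x² = y² with 5x²y² = 1, and 3 - (x ± y)² = 2(1 ∓ xy) with (1 - xy)(1 + xy)
  -- = 4/5.
  · linear_combination h2 - 5 * x ^ 2 * h1
  · linear_combination h2 - 5 * y ^ 2 * h1
  · rw [hs]; linear_combination (-5 / 8 - 5 / 8 * x * y) * h1 - 1 / 4 * h2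
  · rw [hs]; linear_combination (-5 / 8 + 5 / 8 * x * y) * h1 - 1 / 4 * h2

/-- Tangent vectors have (a, b) = k(-y, x), and in the coordinates k, c the form is diagonal: 75k² +
111c². -/
theorem ico_hess_bound {x y a b c : ℝ} (h1 : x ^ 2 + y ^ 2 = 1) (h2 : 5 * (x ^ 2 * y ^ 2) = 1)
    (ho : x * a + y * b = 0) :
    75 * (a ^ 2 + b ^ 2 + c ^ 2) ≤
      6 * (1 + x ^ 2) * (5 * x ^ 2) ^ 2 * a ^ 2 + 6 * (1 + y ^ 2) * (5 * y ^ 2) ^ 2 * b ^ 2 +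
      6 * c ^ 2 + 12 * (3 + (x + y) ^ 2) * (5 / 8 * (1 + x * y)) ^ 2 *
        ((a + b + c) ^ 2 + (a + b - c) ^ 2) +
      12 * (3 + (x - y) ^ 2) * (5 / 8 * (1 - x * y)) ^ 2 *
        ((a - b + c) ^ 2 + (-a + b + c) ^ 2) := by
  set k := x * b - y * a with hk
  have ha : a = -(y * k) := by rw [hk]; linear_combination (-a) * h1 + x * ho
  have hb : b = x * k := by rw [hk]; linear_combination (-b) * h1 + y * ho
  clear_value k
  have key : 6 * (1 + x ^ 2) * (5 * x ^ 2) ^ 2 * a ^ 2 + 6 * (1 + y ^ 2) * (5 * y ^ 2) ^ 2 * b ^ 2 +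
      6 * c ^ 2 + 12 * (3 + (x + y) ^ 2) * (5 / 8 * (1 + x * y)) ^ 2 *
        ((a + b + c) ^ 2 + (a + b - c) ^ 2) +
      12 * (3 + (x - y) ^ 2) * (5 / 8 * (1 - x * y)) ^ 2 *
        ((a - b + c) ^ 2 + (-a + b + c) ^ 2) = 75 * k ^ 2 + 111 * c ^ 2 := by
    subst ha hb
    grind
  have key2 : a ^ 2 + b ^ 2 = k ^ 2 := by rw [ha, hb]; linear_combination k ^ 2 * h1
  rw [key, key2]
  nlinarith [sq_nonneg c]

/-- The golden ratio enters only through 5φ² = (1 + φ²)². The resulting relations are symmetric in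
the two nonzero coordinates, so only the position of the zero matters. -/
theorem icoPoints_coords {u : E3} (hu : u ∈ icoPoints) :
    (u 2 = 0 ∧ u 0 ^ 2 + u 1 ^ 2 = 1 ∧ 5 * (u 0 ^ 2 * u 1 ^ 2) = 1) ∨
    (u 0 = 0 ∧ u 1 ^ 2 + u 2 ^ 2 = 1 ∧ 5 * (u 1 ^ 2 * u 2 ^ 2) = 1) ∨
    (u 1 = 0 ∧ u 2 ^ 2 + u 0 ^ 2 = 1 ∧ 5 * (u 2 ^ 2 * u 0 ^ 2) = 1) := by
  obtain ⟨σ, h0, h1, h2⟩ := hu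
  have hφ := Real.goldenRatio_sq
  have hφ0 := Real.goldenRatio_pos
  generalize goldenRatio = f at *
  have hpos : 0 < 1 + f ^ 2 := by positivity
  have a2 : u (σ 0) ^ 2 = f ^ 2 / (1 + f ^ 2) := by
    rw [← sq_abs, h0, div_pow, Real.sq_sqrt hpos.le]
  have b2 : u (σ 1) ^ 2 = 1 / (1 + f ^ 2) := by
    rw [← sq_abs, h1, div_pow, Real.sq_sqrt hpos.le, one_pow]
  have hs : u (σ 0) ^ 2 + u (σ 1) ^ 2 = 1 := by
    rw [a2, b2, ← add_div, add_comm, div_self hpos.ne']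
  have hm : 5 * (u (σ 0) ^ 2 * u (σ 1) ^ 2) = 1 := by
    have : 5 * f ^ 2 = (1 + f ^ 2) ^ 2 := by
      linear_combination (1 - f ^ 2 - f) * hφ
    rw [a2, b2, div_mul_div_comm, mul_one, ← sq, ← mul_div_assoc, this, div_self (by positivity)]
  have n01 : σ 0 ≠ σ 1 := σ.injective.ne (by decide)
  have n02 : σ 0 ≠ σ 2 := σ.injective.ne (by decide)
  have n12 : σ 1 ≠ σ 2 := σ.injective.ne (by decide)
  generalize σ 0 = i at *
  generalize σ 1 = j at *
  generalize σ 2 = k at *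
  rw [add_comm] at hs
  fin_cases i <;> fin_cases j <;> fin_cases k <;> simp at n01 n02 n12 <;> simp at hs hm h2 <;>
    simp only [h2, true_and] <;> first
    | exact Or.inl ⟨by linarith, by linarith⟩
    | exact Or.inr (Or.inl ⟨by linarith, by linarith⟩)
    | exact Or.inr (Or.inr ⟨by linarith, by linarith⟩)

/-- The three cases differ by a cyclic shift of the coordinates. In each, `ico_weights` replaces the
denominators by polynomials, and the tangential bound is `ico_hess_bound`. -/
theorem icoPoints_critical {u : E3} (hu : u ∈ icoPoints) :
    ‖u‖ = 1 ∧ u ∈ regular Finset.univ ∧ grad u = (60 : ℝ) • u ∧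
    ∀ w, inner ℝ u w = 0 → (60 + 15 : ℝ) * ‖w‖ ^ 2 ≤ inner ℝ (hess u w) w := by
  have hinner : ∀ v : E3, inner ℝ (axis 0) v = v 0 ∧ inner ℝ (axis 1) v = v 1 ∧
      inner ℝ (axis 2) v = v 2 ∧ inner ℝ (axis 3) v = v 0 + v 1 + v 2 ∧
      inner ℝ (axis 4) v = v 0 + v 1 - v 2 ∧ inner ℝ (axis 5) v = v 0 - v 1 + v 2 ∧
      inner ℝ (axis 6) v = -v 0 + v 1 + v 2 := fun v => by
    simp [inner_eq_sum, axis, sub_eq_add_neg]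
  obtain ⟨i0, i1, i2, i3, i4, i5, i6⟩ := hinner u
  have key : u 0 ^ 2 + u 1 ^ 2 + u 2 ^ 2 = 1 → ‖u‖ = 1 := fun h =>
    (pow_eq_one_iff_of_nonneg (norm_nonneg _) two_ne_zero).1 ((norm_sq_eq_sum u).trans h)
  rcases icoPoints_coords hu with ⟨hz, h1, h2⟩ | ⟨hz, h1, h2⟩ | ⟨hz, h1, h2⟩
  · obtain ⟨wx, wy, wp, wm⟩ := ico_weights h1 h2
    have W0 : 0 < axisSq 0 - inner ℝ (axis 0) u ^ 2 ∧
        (axisSq 0 - inner ℝ (axis 0) u ^ 2)⁻¹ = 5 * u 0 ^ 2 := by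
      rw [i0]; exact wx
    have W1 : 0 < axisSq 1 - inner ℝ (axis 1) u ^ 2 ∧
        (axisSq 1 - inner ℝ (axis 1) u ^ 2)⁻¹ = 5 * u 1 ^ 2 := by
      rw [i1]; exact wy
    have W2 : 0 < axisSq 2 - inner ℝ (axis 2) u ^ 2 ∧
        (axisSq 2 - inner ℝ (axis 2) u ^ 2)⁻¹ = 1 := by
      rw [i2, hz]; norm_num [show axisSq 2 = 1 from rfl]
    have W3 : 0 < axisSq 3 - inner ℝ (axis 3) u ^ 2 ∧
        (axisSq 3 - inner ℝ (axis 3) u ^ 2)⁻¹ = 5 / 8 * (1 + u 0 * u 1) := by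
      rw [i3]; exact wp _ (by rw [hz]; ring)
    have W4 : 0 < axisSq 4 - inner ℝ (axis 4) u ^ 2 ∧
        (axisSq 4 - inner ℝ (axis 4) u ^ 2)⁻¹ = 5 / 8 * (1 + u 0 * u 1) := by
      rw [i4]; exact wp _ (by rw [hz]; ring)
    have W5 : 0 < axisSq 5 - inner ℝ (axis 5) u ^ 2 ∧
        (axisSq 5 - inner ℝ (axis 5) u ^ 2)⁻¹ = 5 / 8 * (1 - u 0 * u 1) := by
      rw [i5]; exact wm _ (by rw [hz]; ring)
    have W6 : 0 < axisSq 6 - inner ℝ (axis 6) u ^ 2 ∧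
        (axisSq 6 - inner ℝ (axis 6) u ^ 2)⁻¹ = 5 / 8 * (1 - u 0 * u 1) := by
      rw [i6]; exact wm _ (by rw [hz]; ring)
    refine ⟨key (by rw [hz]; linarith), regular_univ_iff.2
      ⟨W0.1, W1.1, W2.1, W3.1, W4.1, W5.1, W6.1⟩, ?_, fun w hw => ?_⟩
    · simp only [grad, partGrad, Fin.sum_univ_seven, div_eq_mul_inv, W0.2, W1.2, W2.2, W3.2, W4.2,
        W5.2, W6.2]
      simp only [i0, i1, i2, i3, i4, i5, i6, hz]
      apply ext3 <;> simp [axis, axisMult, hz]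
      · linear_combination (30 * u 0) * h1
      · linear_combination (30 * u 1) * h1
      · ring
    · rw [inner_eq_sum, hz] at hw
      have hb := ico_hess_bound (a := w 0) (b := w 1) (c := w 2) h1 h2 (by linarith)
      obtain ⟨j0, j1, j2, j3, j4, j5, j6⟩ := hinner w
      rw [norm_sq_eq_sum, inner_hess]
      simp only [Fin.sum_univ_seven, div_eq_mul_inv, ← inv_pow, W0.2, W1.2, W2.2, W3.2, W4.2,
        W5.2, W6.2]
      simp only [i0, i1, i2, i3, i4, i5, i6, j0, j1, j2, j3, j4, j5, j6, hz, axisMult, axisSq, Matrix.cons_val]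
      convert hb using 1 <;> ring
  · obtain ⟨wx, wy, wp, wm⟩ := ico_weights h1 h2
    have W0 : 0 < axisSq 0 - inner ℝ (axis 0) u ^ 2 ∧
        (axisSq 0 - inner ℝ (axis 0) u ^ 2)⁻¹ = 1 := by
      rw [i0, hz]; norm_num [show axisSq 0 = 1 from rfl]
    have W1 : 0 < axisSq 1 - inner ℝ (axis 1) u ^ 2 ∧
        (axisSq 1 - inner ℝ (axis 1) u ^ 2)⁻¹ = 5 * u 1 ^ 2 := by
      rw [i1]; exact wx
    have W2 : 0 < axisSq 2 - inner ℝ (axis 2) u ^ 2 ∧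
        (axisSq 2 - inner ℝ (axis 2) u ^ 2)⁻¹ = 5 * u 2 ^ 2 := by
      rw [i2]; exact wy
    have W3 : 0 < axisSq 3 - inner ℝ (axis 3) u ^ 2 ∧
        (axisSq 3 - inner ℝ (axis 3) u ^ 2)⁻¹ = 5 / 8 * (1 + u 1 * u 2) := by
      rw [i3]; exact wp _ (by rw [hz]; ring)
    have W4 : 0 < axisSq 4 - inner ℝ (axis 4) u ^ 2 ∧
        (axisSq 4 - inner ℝ (axis 4) u ^ 2)⁻¹ = 5 / 8 * (1 - u 1 * u 2) := by
      rw [i4]; exact wm _ (by rw [hz]; ring)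
    have W5 : 0 < axisSq 5 - inner ℝ (axis 5) u ^ 2 ∧
        (axisSq 5 - inner ℝ (axis 5) u ^ 2)⁻¹ = 5 / 8 * (1 - u 1 * u 2) := by
      rw [i5]; exact wm _ (by rw [hz]; ring)
    have W6 : 0 < axisSq 6 - inner ℝ (axis 6) u ^ 2 ∧
        (axisSq 6 - inner ℝ (axis 6) u ^ 2)⁻¹ = 5 / 8 * (1 + u 1 * u 2) := by
      rw [i6]; exact wp _ (by rw [hz]; ring)
    refine ⟨key (by rw [hz]; linarith), regular_univ_iff.2
      ⟨W0.1, W1.1, W2.1, W3.1, W4.1, W5.1, W6.1⟩, ?_, fun w hw => ?_⟩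
    · simp only [grad, partGrad, Fin.sum_univ_seven, div_eq_mul_inv, W0.2, W1.2, W2.2, W3.2, W4.2,
        W5.2, W6.2]
      simp only [i0, i1, i2, i3, i4, i5, i6, hz]
      apply ext3 <;> simp [axis, axisMult, hz]
      · ring
      · linear_combination (30 * u 1) * h1
      · linear_combination (30 * u 2) * h1
    · rw [inner_eq_sum, hz] at hw
      have hb := ico_hess_bound (a := w 1) (b := w 2) (c := w 0) h1 h2 (by linarith)
      obtain ⟨j0, j1, j2, j3, j4, j5, j6⟩ := hinner w
      rw [norm_sq_eq_sum, inner_hess]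
      simp only [Fin.sum_univ_seven, div_eq_mul_inv, ← inv_pow, W0.2, W1.2, W2.2, W3.2, W4.2,
        W5.2, W6.2]
      simp only [i0, i1, i2, i3, i4, i5, i6, j0, j1, j2, j3, j4, j5, j6, hz, axisMult, axisSq, Matrix.cons_val]
      convert hb using 1 <;> ring
  · obtain ⟨wx, wy, wp, wm⟩ := ico_weights h1 h2
    have W0 : 0 < axisSq 0 - inner ℝ (axis 0) u ^ 2 ∧
        (axisSq 0 - inner ℝ (axis 0) u ^ 2)⁻¹ = 5 * u 0 ^ 2 := by
      rw [i0]; exact wy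
    have W1 : 0 < axisSq 1 - inner ℝ (axis 1) u ^ 2 ∧
        (axisSq 1 - inner ℝ (axis 1) u ^ 2)⁻¹ = 1 := by
      rw [i1, hz]; norm_num [show axisSq 1 = 1 from rfl]
    have W2 : 0 < axisSq 2 - inner ℝ (axis 2) u ^ 2 ∧
        (axisSq 2 - inner ℝ (axis 2) u ^ 2)⁻¹ = 5 * u 2 ^ 2 := by
      rw [i2]; exact wx
    have W3 : 0 < axisSq 3 - inner ℝ (axis 3) u ^ 2 ∧
        (axisSq 3 - inner ℝ (axis 3) u ^ 2)⁻¹ = 5 / 8 * (1 + u 2 * u 0) := by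
      rw [i3]; exact wp _ (by rw [hz]; ring)
    have W4 : 0 < axisSq 4 - inner ℝ (axis 4) u ^ 2 ∧
        (axisSq 4 - inner ℝ (axis 4) u ^ 2)⁻¹ = 5 / 8 * (1 - u 2 * u 0) := by
      rw [i4]; exact wm _ (by rw [hz]; ring)
    have W5 : 0 < axisSq 5 - inner ℝ (axis 5) u ^ 2 ∧
        (axisSq 5 - inner ℝ (axis 5) u ^ 2)⁻¹ = 5 / 8 * (1 + u 2 * u 0) := by
      rw [i5]; exact wp _ (by rw [hz]; ring)
    have W6 : 0 < axisSq 6 - inner ℝ (axis 6) u ^ 2 ∧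
        (axisSq 6 - inner ℝ (axis 6) u ^ 2)⁻¹ = 5 / 8 * (1 - u 2 * u 0) := by
      rw [i6]; exact wm _ (by rw [hz]; ring)
    refine ⟨key (by rw [hz]; linarith), regular_univ_iff.2
      ⟨W0.1, W1.1, W2.1, W3.1, W4.1, W5.1, W6.1⟩, ?_, fun w hw => ?_⟩
    · simp only [grad, partGrad, Fin.sum_univ_seven, div_eq_mul_inv, W0.2, W1.2, W2.2, W3.2, W4.2,
        W5.2, W6.2]
      simp only [i0, i1, i2, i3, i4, i5, i6, hz]
      apply ext3 <;> simp [axis, axisMult, hz]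
      · linear_combination (30 * u 0) * h1
      · ring
      · linear_combination (30 * u 2) * h1
    · rw [inner_eq_sum, hz] at hw
      have hb := ico_hess_bound (a := w 2) (b := w 0) (c := w 1) h1 h2 (by linarith)
      obtain ⟨j0, j1, j2, j3, j4, j5, j6⟩ := hinner w
      rw [norm_sq_eq_sum, inner_hess]
      simp only [Fin.sum_univ_seven, div_eq_mul_inv, ← inv_pow, W0.2, W1.2, W2.2, W3.2, W4.2,
        W5.2, W6.2]
      simp only [i0, i1, i2, i3, i4, i5, i6, j0, j1, j2, j3, j4, j5, j6, hz, axisMult, axisSq, Matrix.cons_val]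
      convert hb using 1 <;> ring

/-! ### Orbits of the distinguished points -/

theorem range_rho (g : Fin 12 ≃ tetGroup) (u : E3) :
    range (rho g u) = range fun k => rot (tetElt k) u := by
  ext v
  constructor
  · rintro ⟨j, rfl⟩
    obtain ⟨k, hk⟩ := mem_tetGroup_iff.1 (g j).2
    exact ⟨k, by simp only [hk]; rfl⟩
  · rintro ⟨k, rfl⟩
    exact ⟨g.symm (tetEquiv k), by simp [rho, tetEquiv_coe]⟩

/-- The points `v` with `|v i| = a`, `|v (i + e)| = b` and `v (i + e + e) = 0` for some `i`. -/
def cyclicPoints (a b : ℝ) (e : Fin 3) : Set E3 :=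
  {v | ∃ i : Fin 3, |v i| = a ∧ |v (i + e)| = b ∧ v (i + e + e) = 0}

theorem abs_evenSigns (d : Fin 4) (j : Fin 3) : |(evenSigns d j : ℝ)| = 1 := by
  fin_cases d <;> fin_cases j <;> simp [evenSigns]

/-- The sign of the third coordinate is free and serves to make the number of minus signs even. -/
theorem exists_evenSigns : ∀ j e : Fin 3, e ≠ 0 → ∀ s s' : Bool, ∃ d,
    evenSigns d j = (if s then 1 else -1) ∧ evenSigns d (j + e) = (if s' then 1 else -1) := by
  decide +kernel

theorem exists_sign_of_abs_eq {a b : ℝ} (h : |a| = |b|) :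
    ∃ s : Bool, a = ((if s then 1 else -1 : ℤ) : ℝ) * b := by
  rcases abs_eq_abs.1 h with h | h
  · exact ⟨true, by simp [h]⟩
  · exact ⟨false, by simp [h]⟩

theorem fin_three_cover : ∀ i e j : Fin 3, e ≠ 0 → j = i ∨ j = i + e ∨ j = i + e + e := by
  decide

/-- Cyclic shifts move the zero to any place; since the sign of a zero is irrelevant, even sign
changes realise all signs of the other two coordinates. -/
theorem range_rho_of_mem_cyclicPoints (g : Fin 12 ≃ tetGroup) {a b : ℝ} {e : Fin 3} (he : e ≠ 0)
    {u : E3} (hu : u ∈ cyclicPoints a b e) : range (rho g u) = cyclicPoints a b e := by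
  obtain ⟨i, ha, hb, hc⟩ := hu
  rw [range_rho]
  ext v
  constructor
  · rintro ⟨⟨d, m⟩, rfl⟩
    refine ⟨i - m, ?_, ?_, ?_⟩ <;> rw [rot_tetElt]
    · rw [abs_mul, abs_evenSigns, one_mul, sub_add_cancel, ha]
    · rw [abs_mul, abs_evenSigns, one_mul, show i - m + e + m = i + e by abel, hb]
    · rw [show i - m + e + e + m = i + e + e by abel, hc, mul_zero]
  · rintro ⟨j, ha', hb', hc'⟩
    obtain ⟨s, hs⟩ := exists_sign_of_abs_eq (ha'.trans ha.symm)
    obtain ⟨s', hs'⟩ := exists_sign_of_abs_eq (hb'.trans hb.symm)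
    obtain ⟨d, hd, hd'⟩ := exists_evenSigns j e he s s'
    refine ⟨(d, i - j), ?_⟩
    ext l
    simp only [rot_tetElt]
    rcases fin_three_cover j e l he with rfl | rfl | rfl
    · rw [hd, add_sub_cancel, hs]
    · rw [hd', show j + e + (i - j) = i + e by abel, hs']
    · rw [show j + e + e + (i - j) = i + e + e by abel, hc, hc', mul_zero]

theorem stdIcosahedron_eq : stdIcosahedron = cyclicPoints (goldenRatio / √(1 + goldenRatio ^ 2))
    (1 / √(1 + goldenRatio ^ 2)) 1 := by
  ext v
  simp only [stdIcosahedron, cyclicPoints, mem_ofPred_eq, add_assoc, show (1 : Fin 3) + 1 = 2 from rfl]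

theorem mem_cyclicPoints_of_icoPoints {u : E3} (hu : u ∈ icoPoints) : ∃ e : Fin 3,
    (e = 1 ∨ e = 2) ∧ u ∈ cyclicPoints (goldenRatio / √(1 + goldenRatio ^ 2))
      (1 / √(1 + goldenRatio ^ 2)) e := by
  obtain ⟨σ, h0, h1, h2⟩ := hu
  have n01 : σ 0 ≠ σ 1 := σ.injective.ne (by decide)
  have n02 : σ 0 ≠ σ 2 := σ.injective.ne (by decide)
  have n12 : σ 1 ≠ σ 2 := σ.injective.ne (by decide)
  have key : ∀ i j k : Fin 3, i ≠ j → i ≠ k → j ≠ k →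
      (i + 1 = j ∧ i + 1 + 1 = k) ∨ (i + 2 = j ∧ i + 2 + 2 = k) := by decide
  rcases key _ _ _ n01 n02 n12 with ⟨hj, hk⟩ | ⟨hj, hk⟩
  · exact ⟨1, Or.inl rfl, σ 0, h0, by rwa [hj], by rwa [hk]⟩
  · exact ⟨2, Or.inr rfl, σ 0, h0, by rwa [hj], by rwa [hk]⟩

/-- Transposing two coordinates reverses the cyclic order, so the 24 points form two congruent
icosahedra. -/
theorem cyclicPoints_two (a b : ℝ) : cyclicPoints a b 2 =
    LinearIsometryEquiv.piLpCongrLeft 2 ℝ ℝ (Equiv.swap (0 : Fin 3) 1) '' cyclicPoints a b 1 := by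
  have happ : ∀ (v : E3) (i : Fin 3),
      LinearIsometryEquiv.piLpCongrLeft 2 ℝ ℝ (Equiv.swap (0 : Fin 3) 1) v i =
        v (Equiv.swap 0 1 i) := fun v i => by
    simp [LinearIsometryEquiv.piLpCongrLeft_apply, Equiv.piCongrLeft'_apply]
  have hsw : ∀ e e' : Fin 3, (e = 1 ∧ e' = 2 ∨ e = 2 ∧ e' = 1) → ∀ i : Fin 3,
      Equiv.swap 0 1 (Equiv.swap 0 1 i + e) = i + e' ∧
      Equiv.swap 0 1 (Equiv.swap 0 1 i + e + e) = i + e' + e' := by decide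
  ext v
  constructor
  · rintro ⟨i, ha, hb, hc⟩
    obtain ⟨q1, q2⟩ := hsw 1 2 (by simp) i
    refine ⟨LinearIsometryEquiv.piLpCongrLeft 2 ℝ ℝ (Equiv.swap (0 : Fin 3) 1) v,
      ⟨Equiv.swap 0 1 i, ?_, ?_, ?_⟩, ?_⟩
    · rw [happ, Equiv.swap_apply_self, ha]
    · rw [happ, q1, hb]
    · rw [happ, q2, hc]
    · ext l
      rw [happ, happ, Equiv.swap_apply_self]
  · rintro ⟨w, ⟨i, ha, hb, hc⟩, rfl⟩
    obtain ⟨q1, q2⟩ := hsw 2 1 (by simp) i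
    refine ⟨Equiv.swap 0 1 i, ?_, ?_, ?_⟩
    · rw [happ, Equiv.swap_apply_self, ha]
    · rw [happ, q1, hb]
    · rw [happ, q2, hc]

theorem isRegularIcosahedron_range_rho (g : Fin 12 ≃ tetGroup) {u : E3} (hu : u ∈ icoPoints) :
    IsRegularIcosahedron (range (rho g u)) := by
  obtain ⟨e, he, hue⟩ := mem_cyclicPoints_of_icoPoints hu
  rw [range_rho_of_mem_cyclicPoints g (by rcases he with rfl | rfl <;> decide) hue]
  rcases he with rfl | rfl
  · exact ⟨LinearIsometryEquiv.refl ℝ E3, by rw [stdIcosahedron_eq]; simp⟩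
  · exact ⟨_, by rw [stdIcosahedron_eq]; exact cyclicPoints_two _ _⟩

/-- The point `c • w` of space with integral direction `w`. -/
def scaledInt (c : ℝ) (w : Fin 3 → ℤ) : E3 := c • WithLp.toLp 2 fun i => (w i : ℝ)

theorem scaledInt_injective {c : ℝ} (hc : c ≠ 0) : Function.Injective (scaledInt c) := by
  intro w w' h
  have := smul_right_injective E3 hc h
  funext i
  have hi : (w i : ℝ) = w' i := congrArg (fun v : E3 => v i) this
  exact_mod_cast hi

theorem rot_scaledInt (k : Fin 4 × Fin 3) (c : ℝ) (w : Fin 3 → ℤ) :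
    rot (tetElt k) (scaledInt c w) = scaledInt c fun j => evenSigns k.1 j * w (j + k.2) := by
  ext j
  rw [rot_tetElt]
  simp [scaledInt]
  ring

/-- Passing to integral directions reduces orbit and multiplicities to counts over the twelve group
elements; the ordering g is only a bijection with them. -/
theorem isCollisionAt_scaledInt (g : Fin 12 ≃ tetGroup) {c : ℝ} (hc : c ≠ 0)
    {W : Finset (Fin 3 → ℤ)} {w : Fin 3 → ℤ} {n : ℕ} (hn : 0 < n)
    (h₁ : ∀ k : Fin 4 × Fin 3, (fun j => evenSigns k.1 j * w (j + k.2)) ∈ W)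
    (h₂ : ∀ q ∈ W, (Finset.univ.filter fun k : Fin 4 × Fin 3 =>
      (fun j => evenSigns k.1 j * w (j + k.2)) = q).card = n) :
    IsCollisionAt (rho g (scaledInt c w)) (scaledInt c '' W) n := by
  constructor
  · rw [range_rho]
    ext v
    constructor
    · rintro ⟨k, rfl⟩
      exact ⟨_, h₁ k, (rot_scaledInt k c w).symm⟩
    · rintro ⟨q, hq, rfl⟩
      obtain ⟨k, hk⟩ := Finset.card_pos.1 ((h₂ q hq).symm ▸ hn)
      exact ⟨k, by simp only [rot_scaledInt, (Finset.mem_filter.1 hk).2]⟩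
  · rintro _ ⟨q, hq, rfl⟩
    have : {j | rho g (scaledInt c w) j = scaledInt c q} = (fun k => g.symm (tetEquiv k)) ''
        (Finset.univ.filter fun k : Fin 4 × Fin 3 =>
          (fun j => evenSigns k.1 j * w (j + k.2)) = q : Finset _) := by
      ext j
      simp only [mem_ofPred_eq, mem_image, Finset.coe_filter, Finset.mem_univ, true_and]
      constructor
      · intro hj
        refine ⟨tetEquiv.symm (g j), ?_, by simp⟩
        apply scaledInt_injective hc
        rw [← hj, ← rot_scaledInt, ← tetEquiv_coe, Equiv.apply_symm_apply]
        rfl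
      · rintro ⟨k, hk, rfl⟩
        rw [rho, Equiv.apply_symm_apply, tetEquiv_coe, rot_scaledInt, hk]
    rw [this, Set.ncard_image_of_injective (f := fun k => g.symm (tetEquiv k)) _
      (g.symm.injective.comp tetEquiv.injective), Set.ncard_coe_finset, h₂ q hq]

/-- The integral directions of the vertices of the first tetrahedron. -/
def tetDirs : Finset (Fin 3 → ℤ) := {![1, 1, 1], ![-1, -1, 1], ![-1, 1, -1], ![1, -1, -1]}

/-- The integral directions of the vertices of the second tetrahedron. -/
def tetDirs' : Finset (Fin 3 → ℤ) := {![-1, -1, -1], ![1, 1, -1], ![1, -1, 1], ![-1, 1, 1]}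

/-- The integral vertices of the octahedron. -/
def octaDirs : Finset (Fin 3 → ℤ) :=
  {![1, 0, 0], ![-1, 0, 0], ![0, 1, 0], ![0, -1, 0], ![0, 0, 1], ![0, 0, -1]}

theorem toLp_int (a b c : ℤ) :
    (WithLp.toLp 2 fun i => ((![a, b, c] i : ℤ) : ℝ)) = (!₂[(a : ℝ), b, c] : E3) := by
  ext i; fin_cases i <;> rfl

theorem tet1_eq : tet1 = scaledInt (√3)⁻¹ '' tetDirs := by
  ext u
  simp [tet1, tetDirs, scaledInt, toLp_int, eq_comm]

theorem tet2_eq : tet2 = scaledInt (√3)⁻¹ '' tetDirs' := by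
  ext u
  simp [tet2, tetDirs', scaledInt, toLp_int, eq_comm]

theorem octa_eq : octa = scaledInt 1 '' octaDirs := by
  ext u
  simp [octa, octaDirs, scaledInt, toLp_int, eq_comm]

/-- The integral directions of the axes. -/
def axisDir : Fin 7 → Fin 3 → ℤ :=
  ![![1, 0, 0], ![0, 1, 0], ![0, 0, 1], ![1, 1, 1], ![1, 1, -1], ![1, -1, 1], ![-1, 1, 1]]

theorem axis_eq (k : Fin 7) : axis k = scaledInt 1 (axisDir k) := by
  fin_cases k <;> apply ext3 <;> simp [axis, axisDir, scaledInt]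

theorem axisSq_eq (k : Fin 7) : axisSq k = ((∑ i, axisDir k i ^ 2 : ℤ) : ℝ) := by
  fin_cases k <;> simp [axisSq, axisDir, Fin.sum_univ_three]

theorem inner_axis_scaledInt (k : Fin 7) (c : ℝ) (w : Fin 3 → ℤ) :
    inner ℝ (axis k) (scaledInt c w) = c * ((∑ i, axisDir k i * w i : ℤ) : ℝ) := by
  rw [axis_eq, inner_eq_sum, Fin.sum_univ_three]
  simp [scaledInt]
  ring

/-- The sign s allows the pole to be opposite to the listed axis. The hypothesis `hr` is strict
Cauchy–Schwarz with every other axis, which is regularity there, in integers. -/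
theorem convergesToCollision_scaledInt (g : Fin 12 ≃ tetGroup) (hg : g 0 = 1) {c : ℝ} (hc : c ≠ 0)
    {w : Fin 3 → ℤ} {m : ℤ} (hcm : c ^ 2 * m = 1) {s : ℤ} {k : Fin 7} (hs : s ^ 2 = 1)
    (hk : axisDir k = fun i => s * w i) (hm : ∑ i, w i ^ 2 = m)
    (hr : ∀ i, i ≠ k → (∑ j, axisDir i j * w j) ^ 2 < m * ∑ j, axisDir i j ^ 2) :
    ConvergesToCollision g (rho g (scaledInt c w)) := by
  have hsR : (s : ℝ) ^ 2 = 1 := by exact_mod_cast hs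
  have hs0 : (s : ℝ) ≠ 0 := by rintro h; rw [h] at hsR; norm_num at hsR
  have hm0 : axisSq k = m := by
    rw [axisSq_eq, hk, ← hm]
    congr 1
    exact Finset.sum_congr rfl fun i _ => by rw [mul_pow, hs, one_mul]
  have hcm' : (m : ℝ) = (c ^ 2)⁻¹ := eq_inv_of_mul_eq_one_right hcm
  refine convergesToCollision_of_axis g hg (k := k) (c := s * c⁻¹) ?_ ?_ ?_ (mul_ne_zero hs0 (inv_ne_zero hc)) ?_
  · refine (pow_eq_one_iff_of_nonneg (norm_nonneg _) two_ne_zero).1 ?_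
    rw [norm_sq_eq_sum, ← hcm, ← hm, Fin.sum_univ_three]
    simp [scaledInt]
    ring
  · rw [axis_eq, hk]
    ext i
    simp [scaledInt]
    field_simp
  · rw [hm0, hcm', mul_pow, hsR, one_mul, inv_pow]
  · intro i hi
    rw [inner_axis_scaledInt, axisSq_eq, mul_pow]
    have := hr i (Finset.ne_of_mem_erase hi)
    have h' : ((∑ j, axisDir i j * w j : ℤ) : ℝ) ^ 2 < m * ((∑ j, axisDir i j ^ 2 : ℤ) : ℝ) := by
      exact_mod_cast this
    have h2 := mul_lt_mul_of_pos_left h' (by positivity : 0 < c ^ 2)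
    rw [← mul_assoc, hcm, one_mul] at h2
    linarith

theorem tetDirs_orbit : ∀ W ∈ [tetDirs, tetDirs'], ∀ w ∈ W,
    (∀ k : Fin 4 × Fin 3, (fun j => evenSigns k.1 j * w (j + k.2)) ∈ W) ∧
    (∀ q ∈ W, (Finset.univ.filter fun k : Fin 4 × Fin 3 =>
      (fun j => evenSigns k.1 j * w (j + k.2)) = q).card = 3) := by
  decide +kernel

theorem octaDirs_orbit : ∀ w ∈ octaDirs,
    (∀ k : Fin 4 × Fin 3, (fun j => evenSigns k.1 j * w (j + k.2)) ∈ octaDirs) ∧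
    (∀ q ∈ octaDirs, (Finset.univ.filter fun k : Fin 4 × Fin 3 =>
      (fun j => evenSigns k.1 j * w (j + k.2)) = q).card = 2) := by
  decide +kernel

theorem tetDirs_axis : ∀ w ∈ tetDirs ∪ tetDirs', ∃ k, ∃ s ∈ [(1 : ℤ), -1], s ^ 2 = 1 ∧
    (axisDir k = fun i => s * w i) ∧ ∑ i, w i ^ 2 = 3 ∧
    ∀ i, i ≠ k → (∑ j, axisDir i j * w j) ^ 2 < 3 * ∑ j, axisDir i j ^ 2 := by
  decide +kernel

theorem octaDirs_axis : ∀ w ∈ octaDirs, ∃ k, ∃ s ∈ [(1 : ℤ), -1], s ^ 2 = 1 ∧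
    (axisDir k = fun i => s * w i) ∧ ∑ i, w i ^ 2 = 1 ∧
    ∀ i, i ≠ k → (∑ j, axisDir i j * w j) ^ 2 < 1 * ∑ j, axisDir i j ^ 2 := by
  decide +kernel

/-! ### Collision configurations at the tetrahedra and the octahedron -/

theorem collision_tetrahedron (g : Fin 12 ≃ tetGroup) (hg : g 0 = 1) {W : Finset (Fin 3 → ℤ)}
    (hW : W = tetDirs ∨ W = tetDirs') {u : E3} (hu : u ∈ scaledInt (√3)⁻¹ '' W) :
    IsCollisionAt (rho g u) (scaledInt (√3)⁻¹ '' W) 3 ∧ ConvergesToCollision g (rho g u) := by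
  obtain ⟨w, hw, rfl⟩ := hu
  rw [Finset.mem_coe] at hw
  have h3 : (√3)⁻¹ ≠ 0 := by positivity
  obtain ⟨h₁, h₂⟩ := tetDirs_orbit W (by simpa using hW) w hw
  obtain ⟨k, s, -, hs, hk, hm, hr⟩ := tetDirs_axis w (by
    rcases hW with rfl | rfl
    · exact Finset.mem_union_left _ hw
    · exact Finset.mem_union_right _ hw)
  exact ⟨isCollisionAt_scaledInt g h3 (by norm_num) h₁ h₂,
    convergesToCollision_scaledInt g hg h3 (by rw [inv_pow, Real.sq_sqrt (by norm_num)]; norm_num)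
      hs hk hm hr⟩

theorem collision_octahedron (g : Fin 12 ≃ tetGroup) (hg : g 0 = 1) {u : E3} (hu : u ∈ octa) :
    IsCollisionAt (rho g u) octa 2 ∧ ConvergesToCollision g (rho g u) := by
  rw [octa_eq] at hu ⊢
  obtain ⟨w, hw, rfl⟩ := hu
  obtain ⟨h₁, h₂⟩ := octaDirs_orbit w hw
  obtain ⟨k, s, -, hs, hk, hm, hr⟩ := octaDirs_axis w hw
  exact ⟨isCollisionAt_scaledInt g one_ne_zero (by norm_num) h₁ h₂,
    convergesToCollision_scaledInt g hg one_ne_zero (by norm_num) hs hk hm hr⟩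

end VortexSphere

end

theorem corollary6p2 :
    Nat.card VortexSphere.tetGroup = 12 ∧
    ∀ g : Fin 12 ≃ VortexSphere.tetGroup, g 0 = 1 →
      (∀ u₀ ∈ VortexSphere.icoPoints,
        VortexSphere.IsRegularIcosahedron (Set.range (VortexSphere.rho g u₀)) ∧
        VortexSphere.IsEquilibrium (VortexSphere.rho g u₀) ∧
        VortexSphere.EmanatesFrom g (VortexSphere.rho g u₀)) ∧
      (∀ S : Set VortexSphere.E3, S = VortexSphere.tet1 ∨ S = VortexSphere.tet2 →
        ∀ u₀ ∈ S,
          VortexSphere.IsCollisionAt (VortexSphere.rho g u₀) S 3 ∧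
          VortexSphere.ConvergesToCollision g (VortexSphere.rho g u₀)) ∧
      (∀ u₀ ∈ VortexSphere.octa,
        VortexSphere.IsCollisionAt (VortexSphere.rho g u₀) VortexSphere.octa 2 ∧
        VortexSphere.ConvergesToCollision g (VortexSphere.rho g u₀)) := by
  refine ⟨VortexSphere.card_tetGroup, fun g hg => ⟨fun u hu => ?_, fun S hS u hu => ?_,
    fun u hu => VortexSphere.collision_octahedron g hg hu⟩⟩
  · obtain ⟨hn, hr, hG, hA⟩ := VortexSphere.icoPoints_critical hu
    exact ⟨VortexSphere.isRegularIcosahedron_range_rho g hu, VortexSphere.isEquilibrium_rho g hn hr hG,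
      VortexSphere.emanatesFrom_of_minimum g hg hn hr hG (by norm_num) hA⟩
  · rcases hS with rfl | rfl
    · rw [VortexSphere.tet1_eq] at hu ⊢
      exact VortexSphere.collision_tetrahedron g hg (Or.inl rfl) hu
    · rw [VortexSphere.tet2_eq] at hu ⊢
      exact VortexSphere.collision_tetrahedron g hg (Or.inr rfl) hu
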